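/- Let $\Omega\subset\mathbb{C}$ be a bounded strictly convex domain with smooth boundary (that is, $\Omega$ is a nonempty bounded convex open set, $\partial\Omega$ is $C^\infty$, and the open segment between any two distinct points of $\overline\Omega$ lies in the interior of $\overline\Omega$), let $q=1_\Omega$ be its characteristic function, let $\sigma\in\{1,-1\}$ and $\epsilon\in\,]0,1]$. Put $\langle z\rangle=(1+|z|^2)^{1/2}$ and let $\langle\cdot\rangle^\epsilon L^2=\{u:\langle\cdot\rangle^{-\epsilon}u\in L^2(\mathbb{C})\}$ with norm $\|u\|=\|\langle\cdot\rangle^{-\epsilon}u\|_{L^2(\mathbb{C})}$. For $k\in\mathbb{C}\setminus\{0\}$ put $h=1/|k|$ and $$ Ef(z)=\frac{1}{\pi h}\int_{\mathbb{C}}\frac{f(w)}{z-w}\,L(dw),\qquad Ff(z)=\frac{1}{\pi h}\int_{\mathbb{C}}\frac{f(w)}{\overline{z-w}}\,L(dw), $$ where $L$ is Lebesgue measure (so that $E=(h\overline\partial)^{-1}$, $F=(h\partial)^{-1}$), and $$ Au=E\Big(e^{\overline{k\,\cdot}-k\,\cdot}\,\frac{hq}{2}\,u\Big),\qquad Bu=\sigma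 F\Big(e^{k\,\cdot-\overline{k\,\cdot}}\,\frac{h\overline q}{2}\,u\Big),\qquad \mathcal{K}=\begin{pmatrix}0&A\\ B&0\end{pmatrix}. $$ Then, for every $k\neq0$, the integrals defining $Au$ and $Bu$ converge absolutely almost everywhere for every $u\in\langle\cdot\rangle^\epsilon L^2$ and define bounded linear operators on $\langle\cdot\rangle^\epsilon L^2$. Moreover, there are constants $C,h_0>0$, depending only on $\Omega$, $\sigma$ and $\epsilon$, such that the following holds for the operator norm on $(\langle\cdot\rangle^\epsilon L^2)^2$. For every $k\neq0$, $$\|\mathcal{K}\|\le C,\qquad \|\mathcal{K}^2\|\le C\,h,$$ and, whenever $0<h\le h_0$, the operators $1-\mathcal{K}$ and $1-\mathcal{K}^2$ on $(\langle\cdot\rangle^\epsilon L^2)^2$ and $1-AB$, $1-BA$ on $\langle\cdot\rangle^\epsilon L^2$ are invertible with bounded inverses, $\|(1-\mathcal{K})^{-1}\|\le C$, and $$ (1-\mathcal{K})^{-1}=(1-\mathcal{K}^2)^{-1}(1+\mathcal{K})= \begin{pmatrix}(1-AB)^{-1}&0\\0&(1-BA)^{-1}\end{pmatrix} \begin{pmatrix}1&A\\B&1\end{pmatrix}.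 $$ -/

import Mathlib

open MeasureTheory Set
open scoped ComplexConjugate ContDiff ENNReal

noncomputable section

namespace DSII

/-- `Ω ⊂ ℂ` is a bounded strictly convex domain with smooth boundary.
Strict convexity is that of the closure: the open segment between two distinct points of the closure
lies in the interior (for the open set itself Mathlib's `StrictConvex` would just mean convex).
Smoothness of the boundary is expressed by local defining functions with non-zero differential. -/
structure IsStrictlyConvexSmoothDomain (Ω : Set ℂ) : Prop where
  isOpen : IsOpen Ω
  nonempty : Ω.Nonempty
  isBounded : Bornology.IsBounded Ω
  convex : Convex ℝ Ω
  strictConvex_closure : StrictConvex ℝ (closure Ω)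
  smooth_boundary : ∀ p ∈ frontier Ω, ∃ (U : Set ℂ) (ρ : ℂ → ℝ),
    IsOpen U ∧ p ∈ U ∧ ContDiffOn ℝ ∞ ρ U ∧ fderiv ℝ ρ p ≠ 0 ∧ Ω ∩ U = {z | ρ z < 0} ∩ U

/-- `⟨z⟩ = (1 + |z|²)^{1/2}`. -/
def japaneseBracket (z : ℂ) : ℝ := Real.sqrt (1 + ‖z‖ ^ 2)

/-- The measure `⟨z⟩^{-2ε} L(dz)`, where `L` is Lebesgue measure on `ℂ`. -/
def weightMeasure (ε : ℝ) : Measure ℂ :=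
  (volume : Measure ℂ).withDensity fun z => ENNReal.ofReal (japaneseBracket z ^ (-2 * ε))

/-- The Hilbert space `⟨·⟩^ε L² = {u : ⟨·⟩^{-ε} u ∈ L²(ℂ)}`, with `‖u‖² = ∫ |⟨z⟩^{-ε} u(z)|² L(dz)`. -/
abbrev WeightedL2 (ε : ℝ) : Type := Lp ℂ 2 (weightMeasure ε)

/-- `E = (h ∂̄)⁻¹`: convolution with the fundamental solution `1 / (π h z)` of `h ∂̄`. -/
def opE (h : ℝ) (f : ℂ → ℂ) (z : ℂ) : ℂ :=
  (1 / (Real.pi * h) : ℂ) * ∫ w : ℂ, f w / (z - w)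

/-- `F = (h ∂)⁻¹`: convolution with the fundamental solution `1 / (π h z̄)` of `h ∂`. -/
def opF (h : ℝ) (f : ℂ → ℂ) (z : ℂ) : ℂ :=
  (1 / (Real.pi * h) : ℂ) * ∫ w : ℂ, f w / conj (z - w)

/-- `τ̂_ω u = e^{kz - conj(kz)} u` with `ω = 2 i k̄ / |k|`. Replacing `k` by `-k` gives `τ̂_{-ω}`. -/
def tau (k : ℂ) (u : ℂ → ℂ) (z : ℂ) : ℂ :=
  Complex.exp (k * z - conj (k * z)) * u z

/-- The function `τ̂_{-ω} (h q / 2) u` to which `E` is applied, `h = 1 / |k|`. -/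
def sourceA (q : ℂ → ℂ) (k : ℂ) (u : ℂ → ℂ) : ℂ → ℂ :=
  tau (-k) fun w => ((1 / ‖k‖ : ℝ) : ℂ) * q w / 2 * u w

/-- The function `τ̂_ω (h q̄ / 2) u` to which `F` is applied, `h = 1 / |k|`. -/
def sourceB (q : ℂ → ℂ) (k : ℂ) (u : ℂ → ℂ) : ℂ → ℂ :=
  tau k fun w => ((1 / ‖k‖ : ℝ) : ℂ) * conj (q w) / 2 * u w

/-- The bounded operator `A` on `⟨·⟩^ε L²` is the operator `E τ̂_{-ω} (h q / 2)`, `h = 1 / |k|`: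
for each `u` the integral defining `E` converges absolutely at almost every point and
gives `A u`. -/
def IsOpA {ε : ℝ} (q : ℂ → ℂ) (k : ℂ) (A : WeightedL2 ε →L[ℂ] WeightedL2 ε) : Prop :=
  ∀ u : WeightedL2 ε,
    (∀ᵐ z : ℂ, Integrable fun w : ℂ => sourceA q k u w / (z - w)) ∧
    ∀ᵐ z : ℂ, A u z = opE (1 / ‖k‖) (sourceA q k u) z

/-- The bounded operator `B` on `⟨·⟩^ε L²` is the operator `σ F τ̂_ω (h q̄ / 2)`, `h = 1 / |k|`:
for each `u` the integral defining `F` converges absolutely at almost every point and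
gives `B u`. -/
def IsOpB {ε : ℝ} (σ : ℂ) (q : ℂ → ℂ) (k : ℂ) (B : WeightedL2 ε →L[ℂ] WeightedL2 ε) : Prop :=
  ∀ u : WeightedL2 ε,
    (∀ᵐ z : ℂ, Integrable fun w : ℂ => sourceB q k u w / conj (z - w)) ∧
    ∀ᵐ z : ℂ, B u z = σ * opF (1 / ‖k‖) (sourceB q k u) z

/-- The operator matrix `((a, b), (c, d))` acting on `X²`. (The square carries the maximum of the two
norms, which is equivalent to the Hilbert norm with absolute constants.) -/
def blockOp {X : Type*} [NormedAddCommGroup X] [NormedSpace ℂ X] (a b c d : X →L[ℂ] X) :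
    X × X →L[ℂ] X × X :=
  (a.coprod b).prod (c.coprod d)

/-- `𝒦 = ((0, A), (B, 0))`. -/
def opK {X : Type*} [NormedAddCommGroup X] [NormedSpace ℂ X] (A B : X →L[ℂ] X) :
    X × X →L[ℂ] X × X :=
  blockOp 0 A B 0

end DSII

end

noncomputable section

namespace DSII

/-! ### The Japanese bracket and its integrability in the plane -/

section Bracket

/-! The whole difficulty is `‖𝒦²‖ = O(h)`. Once `AB` and `BA` have norm at most `1/2`, the Neumann
series inverts `1 - 𝒦²`, and `(1 - 𝒦)(1 + 𝒦) = 1 - 𝒦²` gives the rest (`opK_resolvent`). Since `B u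
= σ conj (A (conj u))`, only `A` is constructed, and the bound for `AB` yields that for `BA`
(`norm_conjOp_mul_le`).

Uniform boundedness of `A` ignores the oscillation. The modulation has modulus one, and the kernel
`|x - z|⁻¹` between a bounded set and the weighted space passes Schur's test, with the potential of
the set itself as test function (`exists_lintegral_weightMeasure_sq_cauchyAbs_le`). The input is
that two Cauchy kernels with poles `x, x'` in a fixed disc, integrated against the weight, give
`O(|x - x'|^{-1/2})`.

For the gain of `h`, duality writes the pairing of `A B u` with `g` as a constant times `∫_Ω e v w`,
where `v` is the conjugate of a Cauchy transform built from `u`, `w` is a Cauchy transform of `g`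
against the weight, and `e` is a character changing sign under translation by some `y` with `|y| =
πh/2`. Integration by parts is replaced by averaging over the translations `0, y, -y`: four times
the integral equals the integral of `e` times the second difference of `1_Ω v w`. A discrete Leibniz
rule expands this difference, with errors only where a translation crosses the boundary
(`enorm_secondDiff_indicator_le`).

In `L²`, relative to the norm of the density, second differences of a Cauchy transform on `Ω` are
`O(|y|)`, while first differences on `Ω` and restrictions to the boundary strips are `O(|y|^{1/2})`
(`exists_hasStripEstimates_cauchyTransform`). All are Schur tests on explicit kernels, and convexity
enters through the thinness of the strips. By Cauchy-Schwarz every product that occurs is then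
`O(|y|)`. This is used for `|y| ≤ 1`; otherwise the uniform bound on `A` suffices. -/

lemma one_le_japaneseBracket (z : ℂ) : 1 ≤ japaneseBracket z := by
  unfold japaneseBracket
  rw [Real.one_le_sqrt]
  nlinarith [sq_nonneg ‖z‖]

lemma japaneseBracket_pos (z : ℂ) : 0 < japaneseBracket z :=
  one_pos.trans_le (one_le_japaneseBracket z)

lemma japaneseBracket_le (z : ℂ) : japaneseBracket z ≤ 1 + ‖z‖ :=
  sqrt_one_add_norm_sq_le z

@[fun_prop]
lemma continuous_japaneseBracket : Continuous japaneseBracket := by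
  unfold japaneseBracket
  fun_prop

@[fun_prop]
lemma measurable_japaneseBracket : Measurable japaneseBracket :=
  continuous_japaneseBracket.measurable

lemma lintegral_japaneseBracket_rpow_lt_top {p : ℝ} (hp : 2 < p) :
    ∫⁻ z : ℂ, ENNReal.ofReal (japaneseBracket z ^ (-p)) < ⊤ := by
  have h := (integrable_rpow_neg_one_add_norm_sq (E := ℂ) (μ := volume) (r := p)
    (by simpa using hp)).lintegral_lt_top
  refine lt_of_le_of_lt (le_of_eq ?_) h
  refine lintegral_congr fun z => ?_
  congr 1
  unfold japaneseBracket
  rw [Real.sqrt_eq_rpow, ← Real.rpow_mul (by positivity)]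
  congr 1
  ring

end Bracket

/-! ### Riesz potentials in the plane -/

section Potentials

/-- The kernel `|x - z|⁻¹`, with the value `0` on the diagonal. -/
def cauchyAbs (x z : ℂ) : ℝ≥0∞ := ENNReal.ofReal (‖x - z‖⁻¹)

lemma lintegral_ball_norm_rpow_lt_top {s : ℝ} (hs : s < 2) :
    ∫⁻ x in Metric.ball (0 : ℂ) 1, ENNReal.ofReal (‖x‖ ^ (-s)) < ⊤ := by
  have h : IntegrableOn (fun x : ℂ => ‖x‖ ^ (-s)) (Metric.ball 0 1) := by
    have := (integrableOn_fun_norm_addHaar (volume : Measure ℂ)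
      (f := fun r : ℝ => r ^ (-s)) (r := 1)).2 ?_
    · exact this
    · have h1 : IntegrableOn (fun r : ℝ => r ^ (1 - s)) (Ioo 0 1) :=
        (intervalIntegral.integrableOn_Ioo_rpow_iff (by norm_num)).2 (by linarith)
      refine h1.congr_fun ?_ measurableSet_Ioo
      intro r hr
      simp only [Complex.finrank_real_complex, smul_eq_mul]
      rw [Real.rpow_sub hr.1, Real.rpow_neg hr.1.le]
      simp [div_eq_mul_inv]
  exact h.lintegral_lt_top

/-- Local Riesz potentials are bounded, uniformly in the pole. -/
lemma exists_lintegral_ball_norm_sub_rpow_le {s : ℝ} (hs0 : 0 ≤ s) (hs : s < 2) (R : ℝ) :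
    ∃ C : ℝ≥0∞, C ≠ ⊤ ∧ ∀ z : ℂ,
      ∫⁻ x in Metric.ball (0 : ℂ) R, ENNReal.ofReal (‖x - z‖ ^ (-s)) ≤ C := by
  refine ⟨(∫⁻ x in Metric.ball (0 : ℂ) 1, ENNReal.ofReal (‖x‖ ^ (-s))) +
    volume (Metric.ball (0 : ℂ) R), ?_, fun z => ?_⟩
  · exact ENNReal.add_ne_top.2 ⟨(lintegral_ball_norm_rpow_lt_top hs).ne, measure_ball_lt_top.ne⟩
  · have hpt : ∀ x : ℂ, ENNReal.ofReal (‖x - z‖ ^ (-s)) ≤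
        (Metric.ball (0 : ℂ) 1).indicator (fun x => ENNReal.ofReal (‖x‖ ^ (-s))) (x - z) + 1 := by
      intro x
      by_cases hx : x - z ∈ Metric.ball (0 : ℂ) 1
      · rw [indicator_of_mem hx]; exact le_self_add
      · rw [indicator_of_notMem hx, zero_add]
        rw [ENNReal.ofReal_le_one]
        have : 1 ≤ ‖x - z‖ := by simpa using hx
        exact Real.rpow_le_one_of_one_le_of_nonpos this (by linarith)
    calc ∫⁻ x in Metric.ball (0 : ℂ) R, ENNReal.ofReal (‖x - z‖ ^ (-s))
        ≤ ∫⁻ x in Metric.ball (0 : ℂ) R,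
          ((Metric.ball (0 : ℂ) 1).indicator (fun x => ENNReal.ofReal (‖x‖ ^ (-s))) (x - z) + 1) :=
          lintegral_mono fun x => hpt x
      _ = (∫⁻ x in Metric.ball (0 : ℂ) R,
          (Metric.ball (0 : ℂ) 1).indicator (fun x => ENNReal.ofReal (‖x‖ ^ (-s))) (x - z)) +
            volume (Metric.ball (0 : ℂ) R) := by
          rw [lintegral_add_right _ measurable_const]; simp
      _ ≤ _ := by
          refine add_le_add_left ((setLIntegral_le_lintegral _ _).trans ?_) _
          rw [lintegral_sub_right_eq_self
            ((Metric.ball (0 : ℂ) 1).indicator (fun x => ENNReal.ofReal (‖x‖ ^ (-s)))) z,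
            lintegral_indicator measurableSet_ball]

/-- Riesz potentials of powers of `⟨z⟩⁻¹` are bounded. -/
lemma exists_lintegral_norm_sub_rpow_mul_japaneseBracket_le {s t : ℝ} (hs0 : 0 < s) (hs : s < 2)
    (hst : 2 < s + t) :
    ∃ C : ℝ≥0∞, C ≠ ⊤ ∧ ∀ x : ℂ,
      ∫⁻ z : ℂ, ENNReal.ofReal (‖x - z‖ ^ (-s) * japaneseBracket z ^ (-t)) ≤ C := by
  set p := s + t with hp
  set I₁ := ∫⁻ x in Metric.ball (0 : ℂ) 1, ENNReal.ofReal (‖x‖ ^ (-s)) with hI₁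
  set I₂ := ∫⁻ z : ℂ, ENNReal.ofReal (japaneseBracket z ^ (-p)) with hI₂
  refine ⟨I₁ + ENNReal.ofReal (2 ^ p) * I₂ + I₂, ?_, fun x => ?_⟩
  · have h1 := (lintegral_ball_norm_rpow_lt_top hs).ne
    have h2 := (lintegral_japaneseBracket_rpow_lt_top hst).ne
    exact ENNReal.add_ne_top.2
      ⟨ENNReal.add_ne_top.2 ⟨h1, ENNReal.mul_ne_top ENNReal.ofReal_ne_top h2⟩, h2⟩
  · have hpt : ∀ z : ℂ, ENNReal.ofReal (‖x - z‖ ^ (-s) * japaneseBracket z ^ (-t)) ≤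
        (Metric.ball (0 : ℂ) 1).indicator (fun x => ENNReal.ofReal (‖x‖ ^ (-s))) (x - z) +
        ENNReal.ofReal (2 ^ p) * ENNReal.ofReal (japaneseBracket (x - z) ^ (-p)) +
        ENNReal.ofReal (japaneseBracket z ^ (-p)) := by
      intro z
      have hJ := one_le_japaneseBracket z
      have hJ0 := japaneseBracket_pos z
      by_cases hx : x - z ∈ Metric.ball (0 : ℂ) 1
      · rw [indicator_of_mem hx, add_assoc]
        refine le_trans ?_ le_self_add
        apply ENNReal.ofReal_le_ofReal
        exact mul_le_of_le_one_right (by positivity)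
          (Real.rpow_le_one_of_one_le_of_nonpos hJ (by linarith))
      · rw [indicator_of_notMem hx, zero_add]
        have h1 : 1 ≤ ‖x - z‖ := by simpa using hx
        have h0 : 0 < ‖x - z‖ := by linarith
        -- Away from the pole, the larger of `|x - z|` and `⟨z⟩` is replaced by the smaller, so the
        -- full exponent `p = s + t > 2` falls on a single factor. For `|x - z| ≥ 1` the bracket of
        -- `x - z` is at most `2|x - z|`, whence the constant `2 ^ p`.
        rcases le_total ‖x - z‖ (japaneseBracket z) with h | h
        · refine le_trans ?_ le_self_add
          rw [← ENNReal.ofReal_mul (by positivity)]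
          apply ENNReal.ofReal_le_ofReal
          calc ‖x - z‖ ^ (-s) * japaneseBracket z ^ (-t)
              ≤ ‖x - z‖ ^ (-s) * ‖x - z‖ ^ (-t) := by
                gcongr ?_ * ?_
                exact Real.rpow_le_rpow_of_nonpos h0 h (by linarith)
            _ = ‖x - z‖ ^ (-p) := by rw [← Real.rpow_add h0]; congr 1; rw [hp]; ring
            _ = 2 ^ p * (2 * ‖x - z‖) ^ (-p) := by
                rw [Real.mul_rpow (by norm_num) h0.le, ← mul_assoc, ← Real.rpow_add (by norm_num)]
                simp
            _ ≤ 2 ^ p * japaneseBracket (x - z) ^ (-p) := by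
                gcongr ?_ * ?_
                refine Real.rpow_le_rpow_of_nonpos (japaneseBracket_pos _) ?_ (by linarith)
                linarith [japaneseBracket_le (x - z)]
        · refine le_trans ?_ le_add_self
          apply ENNReal.ofReal_le_ofReal
          calc ‖x - z‖ ^ (-s) * japaneseBracket z ^ (-t)
              ≤ japaneseBracket z ^ (-s) * japaneseBracket z ^ (-t) := by
                gcongr ?_ * ?_
                exact Real.rpow_le_rpow_of_nonpos hJ0 h (by linarith)
            _ = japaneseBracket z ^ (-p) := by rw [← Real.rpow_add hJ0]; congr 1; rw [hp]; ring
    have hm1 : Measurable fun z : ℂ =>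
        (Metric.ball (0 : ℂ) 1).indicator (fun x => ENNReal.ofReal (‖x‖ ^ (-s))) (x - z) :=
      ((by fun_prop : Measurable fun x : ℂ => ENNReal.ofReal (‖x‖ ^ (-s))).indicator
        measurableSet_ball).comp (by fun_prop)
    refine (lintegral_mono hpt).trans ?_
    rw [lintegral_add_right _ (by fun_prop), lintegral_add_left hm1,
      lintegral_const_mul _ (by fun_prop),
      lintegral_sub_left_eq_self
        ((Metric.ball (0 : ℂ) 1).indicator (fun x => ENNReal.ofReal (‖x‖ ^ (-s)))) x,
      lintegral_sub_left_eq_self (fun z => ENNReal.ofReal (japaneseBracket z ^ (-p))) x,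
      lintegral_indicator measurableSet_ball]

end Potentials

/-! ### Cauchy-Schwarz and Schur tests for nonnegative kernels -/

section Schur

variable {α β : Type*} [MeasurableSpace α] [MeasurableSpace β]

lemma sq_lintegral_mul_le {μ : Measure α} {f g : α → ℝ≥0∞} (hf : AEMeasurable f μ)
    (hg : AEMeasurable g μ) :
    (∫⁻ a, f a * g a ∂μ) ^ 2 ≤ (∫⁻ a, f a ^ 2 ∂μ) * ∫⁻ a, g a ^ 2 ∂μ := by
  have h := ENNReal.lintegral_mul_le_Lp_mul_Lq μ Real.HolderConjugate.two_two hf hg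
  simp only [Pi.mul_apply, ENNReal.rpow_two] at h
  calc _ ≤ ((∫⁻ a, f a ^ 2 ∂μ) ^ (1 / 2 : ℝ) * (∫⁻ a, g a ^ 2 ∂μ) ^ (1 / 2 : ℝ)) ^ 2 := by gcongr
    _ = _ := by
      rw [mul_pow, ← ENNReal.rpow_two, ← ENNReal.rpow_two, ← ENNReal.rpow_mul, ← ENNReal.rpow_mul]
      norm_num

lemma lintegral_mul_le_of_sq_le {μ : Measure α} {f g : α → ℝ≥0∞} (hf : AEMeasurable f μ)
    (hg : AEMeasurable g μ) {a b : ℝ≥0∞} (ha : ∫⁻ x, f x ^ 2 ∂μ ≤ a ^ 2)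
    (hb : ∫⁻ x, g x ^ 2 ∂μ ≤ b ^ 2) : ∫⁻ x, f x * g x ∂μ ≤ a * b := by
  rw [← ENNReal.pow_le_pow_left_iff two_ne_zero, mul_pow]
  exact (sq_lintegral_mul_le hf hg).trans (mul_le_mul' ha hb)

/-- Weighted Cauchy-Schwarz: `(∫ k g)² ≤ ∫ k g² P⁻¹ ∫ k P`. -/
lemma sq_lintegral_mul_le_weight {μ : Measure α} {k g P : α → ℝ≥0∞} (hk : Measurable k)
    (hg : AEMeasurable g μ) (hP : Measurable P) (hP0 : ∀ a, P a ≠ 0) (hPt : ∀ a, P a ≠ ⊤) :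
    (∫⁻ a, k a * g a ∂μ) ^ 2 ≤ (∫⁻ a, k a * g a ^ 2 * (P a)⁻¹ ∂μ) * ∫⁻ a, k a * P a ∂μ := by
  have hsq : ∀ x : ℝ≥0∞, (x ^ (1 / 2 : ℝ)) ^ 2 = x := fun x => by
    rw [← ENNReal.rpow_two, ← ENNReal.rpow_mul]; norm_num
  have hsq' : ∀ x : ℝ≥0∞, x ^ (1 / 2 : ℝ) * x ^ (1 / 2 : ℝ) = x := fun x => by
    rw [← pow_two, hsq]
  have h := sq_lintegral_mul_le (μ := μ)
    (f := fun a => (k a) ^ (1 / 2 : ℝ) * g a * ((P a)⁻¹) ^ (1 / 2 : ℝ))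
    (g := fun a => (k a) ^ (1 / 2 : ℝ) * (P a) ^ (1 / 2 : ℝ))
    (((hk.pow_const _).aemeasurable.mul hg).mul (hP.inv.pow_const _).aemeasurable)
    ((hk.pow_const _).mul (hP.pow_const _)).aemeasurable
  simp only [mul_pow, hsq] at h
  convert h using 4 with a
  have h1 : ((P a)⁻¹) ^ (1 / 2 : ℝ) * (P a) ^ (1 / 2 : ℝ) = 1 := by
    rw [← ENNReal.mul_rpow_of_nonneg _ _ (by norm_num), ENNReal.inv_mul_cancel (hP0 a) (hPt a)]
    simp
  calc k a * g a = (k a ^ (1 / 2 : ℝ) * k a ^ (1 / 2 : ℝ)) * g a *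
        (((P a)⁻¹) ^ (1 / 2 : ℝ) * (P a) ^ (1 / 2 : ℝ)) := by rw [hsq', h1, mul_one]
    _ = _ := by ring

/-- Schur's test with one weight. -/
lemma lintegral_sq_lintegral_le {μ : Measure α} {ν : Measure β} [SFinite μ] [SFinite ν]
    {k : α → β → ℝ≥0∞}
    (hk : Measurable fun p : α × β => k p.1 p.2) {P : β → ℝ≥0∞} (hP : Measurable P)
    (hP0 : ∀ b, P b ≠ 0) (hPt : ∀ b, P b ≠ ⊤) {g : β → ℝ≥0∞} (hg : Measurable g)
    {a c : ℝ≥0∞} (h₁ : ∀ᵐ x ∂μ, ∫⁻ z, k x z * P z ∂ν ≤ a)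
    (h₂ : ∀ z, ∫⁻ x, k x z ∂μ ≤ c * P z) :
    ∫⁻ x, (∫⁻ z, k x z * g z ∂ν) ^ 2 ∂μ ≤ a * c * ∫⁻ z, g z ^ 2 ∂ν := by
  have hkx : ∀ x, Measurable (k x) := fun x => hk.comp (measurable_const.prodMk measurable_id)
  have hm : Measurable fun p : α × β => k p.1 p.2 * g p.2 ^ 2 * (P p.2)⁻¹ := by fun_prop
  calc ∫⁻ x, (∫⁻ z, k x z * g z ∂ν) ^ 2 ∂μ
      ≤ ∫⁻ x, (∫⁻ z, k x z * g z ^ 2 * (P z)⁻¹ ∂ν) * a ∂μ := by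
        refine lintegral_mono_ae (h₁.mono fun x hx => ?_)
        exact (sq_lintegral_mul_le_weight (hkx x) hg.aemeasurable hP hP0 hPt).trans
          (mul_le_mul' le_rfl hx)
    _ = (∫⁻ z, ∫⁻ x, k x z * g z ^ 2 * (P z)⁻¹ ∂μ ∂ν) * a := by
        rw [lintegral_mul_const _ hm.lintegral_prod_right',
          lintegral_lintegral_swap hm.aemeasurable]
    _ ≤ (∫⁻ z, c * g z ^ 2 ∂ν) * a := by
        gcongr with z
        have hkz : Measurable fun x => k x z := hk.comp (measurable_id.prodMk measurable_const)
        simp_rw [mul_assoc]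
        rw [lintegral_mul_const _ hkz]
        calc _ ≤ c * P z * (g z ^ 2 * (P z)⁻¹) := by gcongr; exact h₂ z
          _ = c * g z ^ 2 * ((P z) * (P z)⁻¹) := by ring
          _ = c * g z ^ 2 := by rw [ENNReal.mul_inv_cancel (hP0 z) (hPt z), mul_one]
          _ ≤ _ := le_rfl
    _ = _ := by rw [lintegral_const_mul _ (by fun_prop)]; ring

/-- The transposed Schur test. -/
lemma lintegral_sq_lintegral_le' {μ : Measure α} {ν : Measure β} [SFinite μ] [SFinite ν]
    {k : α → β → ℝ≥0∞}
    (hk : Measurable fun p : α × β => k p.1 p.2) {P : β → ℝ≥0∞} (hP : Measurable P)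
    {g : α → ℝ≥0∞} (hg : Measurable g)
    {a c : ℝ≥0∞} (h₁ : ∀ᵐ x ∂μ, ∫⁻ z, k x z * P z ∂ν ≤ a)
    (h₂ : ∀ z, ∫⁻ x, k x z ∂μ ≤ c * P z) :
    ∫⁻ z, (∫⁻ x, k x z * g x ∂μ) ^ 2 ∂ν ≤ a * c * ∫⁻ x, g x ^ 2 ∂μ := by
  have hkx : ∀ x, Measurable (k x) := fun x => hk.comp (measurable_const.prodMk measurable_id)
  have hkz : ∀ z, Measurable fun x => k x z :=
    fun z => hk.comp (measurable_id.prodMk measurable_const)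
  have hm : Measurable fun p : β × α => k p.2 p.1 * g p.2 ^ 2 * (c * P p.1) := by
    have := hk.comp measurable_swap
    simp only [Function.comp_def, Prod.fst_swap, Prod.snd_swap] at this
    fun_prop
  calc ∫⁻ z, (∫⁻ x, k x z * g x ∂μ) ^ 2 ∂ν
      ≤ ∫⁻ z, (∫⁻ x, k x z * g x ^ 2 * (c * P z) ∂μ) ∂ν := by
        refine lintegral_mono fun z => ?_
        -- With weight `1` the second factor is the marginal of `k` at `z`, which is what `h₂`
        -- bounds by `c * P z`.
        have h := sq_lintegral_mul_le_weight (μ := μ) (hkz z) hg.aemeasurable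
          (measurable_const (a := (1 : ℝ≥0∞))) (by simp) (by simp)
        simp only [inv_one, mul_one] at h
        refine h.trans ?_
        rw [lintegral_mul_const _ (by fun_prop)]
        exact mul_le_mul' le_rfl (h₂ z)
    _ = ∫⁻ x, ∫⁻ z, k x z * g x ^ 2 * (c * P z) ∂ν ∂μ := lintegral_lintegral_swap hm.aemeasurable
    _ ≤ ∫⁻ x, a * c * g x ^ 2 ∂μ := by
        refine lintegral_mono_ae (h₁.mono fun x hx => ?_)
        calc ∫⁻ z, k x z * g x ^ 2 * (c * P z) ∂ν
            = ∫⁻ z, (c * g x ^ 2) * (k x z * P z) ∂ν := by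
              refine lintegral_congr fun z => ?_; ring
          _ = (c * g x ^ 2) * ∫⁻ z, k x z * P z ∂ν := lintegral_const_mul _ ((hkx x).mul hP)
          _ ≤ (c * g x ^ 2) * a := by gcongr
          _ = _ := by ring
    _ = _ := lintegral_const_mul _ (by fun_prop)

end Schur

/-! ### Comparison of the weighted measure with Lebesgue measure -/

section Weight

variable {ε : ℝ}

instance : SFinite (weightMeasure ε) := by
  unfold weightMeasure; infer_instance

lemma lintegral_weightMeasure {f : ℂ → ℝ≥0∞} (hf : Measurable f) :
    ∫⁻ z, f z ∂(weightMeasure ε) =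
      ∫⁻ z, ENNReal.ofReal (japaneseBracket z ^ (-2 * ε)) * f z := by
  unfold weightMeasure
  rw [lintegral_withDensity_eq_lintegral_mul _ (by fun_prop) hf]
  rfl

lemma weightMeasure_le_volume (hε : 0 ≤ ε) : weightMeasure ε ≤ volume := by
  refine Measure.le_iff.2 fun s hs => ?_
  rw [weightMeasure, withDensity_apply _ hs]
  calc _ ≤ ∫⁻ z in s, 1 := by
        gcongr with z
        rw [ENNReal.ofReal_le_one]
        exact Real.rpow_le_one_of_one_le_of_nonpos (one_le_japaneseBracket z) (by linarith)
    _ = volume s := by simp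

lemma volume_absolutelyContinuous_weightMeasure : (volume : Measure ℂ) ≪ weightMeasure ε := by
  refine withDensity_absolutelyContinuous' (by fun_prop) (Filter.Eventually.of_forall fun z => ?_)
  have := Real.rpow_pos_of_pos (japaneseBracket_pos z) (-2 * ε)
  simpa using this

lemma weightMeasure_absolutelyContinuous_volume : weightMeasure ε ≪ (volume : Measure ℂ) :=
  withDensity_absolutelyContinuous _ _

lemma exists_restrict_le_weightMeasure (hε : 0 ≤ ε) (R : ℝ) :
    ∃ K : ℝ≥0∞, K ≠ ⊤ ∧ ∀ s ⊆ Metric.ball (0 : ℂ) R, MeasurableSet s →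
      (volume : Measure ℂ).restrict s ≤ K • weightMeasure ε := by
  refine ⟨ENNReal.ofReal ((1 + |R|) ^ (2 * ε)), ENNReal.ofReal_ne_top, fun s hs hsm => ?_⟩
  refine Measure.le_iff.2 fun t ht => ?_
  rw [Measure.restrict_apply ht, Measure.smul_apply, smul_eq_mul, weightMeasure,
    withDensity_apply _ ht]
  calc volume (t ∩ s) = ∫⁻ z in t ∩ s, 1 := by simp
    _ ≤ ∫⁻ z in t ∩ s, ENNReal.ofReal ((1 + |R|) ^ (2 * ε)) *
        ENNReal.ofReal (japaneseBracket z ^ (-2 * ε)) := by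
        refine setLIntegral_mono (by fun_prop) fun z hz => ?_
        rw [← ENNReal.ofReal_mul (by positivity)]
        rw [ENNReal.one_le_ofReal]
        have hJ := japaneseBracket_pos z
        have h1 : japaneseBracket z ≤ 1 + |R| := by
          have := mem_ball_zero_iff.1 (hs hz.2)
          linarith [japaneseBracket_le z, le_abs_self R]
        calc (1 : ℝ) = japaneseBracket z ^ (2 * ε) * japaneseBracket z ^ (-2 * ε) := by
              rw [← Real.rpow_add hJ]; simp
          _ ≤ _ := by gcongr
    _ ≤ ∫⁻ z in t, ENNReal.ofReal ((1 + |R|) ^ (2 * ε)) *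
        ENNReal.ofReal (japaneseBracket z ^ (-2 * ε)) :=
        lintegral_mono_set inter_subset_left
    _ = _ := lintegral_const_mul _ (by fun_prop)

end Weight

/-! ### Products of two Cauchy kernels -/

section Kernels

variable {ε : ℝ}

/-- Taking square roots in `h` gives `√d √J ≤ √M (√a + √b)`, and `αβ(α + β) ≤ α³ + β³` for `α = √a`,
`β = √b` finishes. The point is to separate the poles of a product of two Cauchy kernels: the
exponent `3/2` stays locally integrable, and half a power of decay in `J` is gained at the price of
`d^{-1/2}`. -/
lemma inv_mul_inv_le_rpow {a b d J M : ℝ} (ha : 0 ≤ a) (hb : 0 ≤ b) (hd : 0 < d) (hJ : 0 < J)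
    (h : d * J ≤ M * (a + b)) :
    a⁻¹ * b⁻¹ ≤ M ^ (1 / 2 : ℝ) * d ^ (-(1 / 2) : ℝ) *
      (J ^ (-(1 / 2) : ℝ) * (a ^ (-(3 / 2) : ℝ) + b ^ (-(3 / 2) : ℝ))) := by
  have hdJ : 0 < d * J := mul_pos hd hJ
  have hM : 0 < M := by
    by_contra hM
    have := mul_nonpos_of_nonpos_of_nonneg (not_lt.1 hM) (add_nonneg ha hb)
    linarith
  -- At a pole the convention `0⁻¹ = 0` makes the left side vanish.
  rcases ha.eq_or_lt with rfl | ha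
  · simp only [inv_zero, zero_mul]; positivity
  rcases hb.eq_or_lt with rfl | hb
  · simp only [inv_zero, mul_zero]; positivity
  have hpow : ∀ x : ℝ, 0 < x → x ^ (-(3 / 2) : ℝ) = ((√x) ^ 3)⁻¹ := fun x hx => by
    rw [Real.sqrt_eq_rpow, ← Real.rpow_natCast, ← Real.rpow_mul hx.le, ← Real.rpow_neg hx.le]
    norm_num
  have hpow' : ∀ x : ℝ, 0 < x → x ^ (-(1 / 2) : ℝ) = (√x)⁻¹ := fun x hx => by
    rw [Real.sqrt_eq_rpow, ← Real.rpow_neg hx.le]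
  rw [hpow _ ha, hpow _ hb, hpow' _ hd, hpow' _ hJ, ← Real.sqrt_eq_rpow]
  have hsub : √(a + b) ≤ √a + √b := by
    refine Real.sqrt_le_iff.2 ⟨by positivity, ?_⟩
    nlinarith [Real.sq_sqrt ha.le, Real.sq_sqrt hb.le, Real.sqrt_nonneg a, Real.sqrt_nonneg b,
      mul_nonneg (Real.sqrt_nonneg a) (Real.sqrt_nonneg b)]
  have h1 : √d * √J ≤ √M * (√a + √b) := by
    rw [← Real.sqrt_mul hd.le]
    refine (Real.sqrt_le_sqrt h).trans ?_
    rw [Real.sqrt_mul hM.le]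
    gcongr
  have hα := Real.sqrt_pos.2 ha
  have hβ := Real.sqrt_pos.2 hb
  have hδ := Real.sqrt_pos.2 hd
  have hj := Real.sqrt_pos.2 hJ
  have hm := Real.sqrt_pos.2 hM
  have ea : a = (√a) ^ 2 := (Real.sq_sqrt ha.le).symm
  have eb : b = (√b) ^ 2 := (Real.sq_sqrt hb.le).symm
  have hlhs : a⁻¹ * b⁻¹ = ((√a) ^ 2)⁻¹ * ((√b) ^ 2)⁻¹ := by rw [← ea, ← eb]
  rw [hlhs]
  generalize √a = α at *
  generalize √b = β at *
  generalize √d = δ at *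
  generalize √J = j at *
  generalize √M = m at *
  have h2 : α * β * (α + β) ≤ α ^ 3 + β ^ 3 := by
    nlinarith [mul_nonneg (add_pos hα hβ).le (sq_nonneg (α - β))]
  have h3 : δ * j * (α * β) ≤ m * (α ^ 3 + β ^ 3) :=
    calc δ * j * (α * β) ≤ m * (α + β) * (α * β) := by gcongr
      _ = m * (α * β * (α + β)) := by ring
      _ ≤ _ := by gcongr
  have h4 : m * δ⁻¹ * (j⁻¹ * ((α ^ 3)⁻¹ + (β ^ 3)⁻¹)) =
      (m * (α ^ 3 + β ^ 3)) / (δ * j * α ^ 3 * β ^ 3) := by field_simp; ring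
  have h5 : (α ^ 2)⁻¹ * (β ^ 2)⁻¹ = (δ * j * (α * β)) / (δ * j * α ^ 3 * β ^ 3) := by field_simp
  rw [h4, h5]
  gcongr

/-- The bracket exceeds `1 + R` by at most `|x - z|`. The triangle inequality through `z` handles
the constant part, and `|x - x'| ≤ 2R` the growing part. This supplies the hypothesis of
`inv_mul_inv_le_rpow`. -/
lemma norm_sub_mul_japaneseBracket_le {R : ℝ} {x x' : ℂ} (hx : ‖x‖ ≤ R) (hx' : ‖x'‖ ≤ R)
    (z : ℂ) : ‖x - x'‖ * japaneseBracket z ≤ (1 + 3 * R) * (‖x - z‖ + ‖x' - z‖) := by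
  have hR : 0 ≤ R := (norm_nonneg x).trans hx
  have h1 : ‖x - x'‖ ≤ ‖x - z‖ + ‖x' - z‖ := by
    rw [norm_sub_rev x' z]; exact norm_sub_le_norm_sub_add_norm_sub x z x'
  have h2 : ‖x - x'‖ ≤ 2 * R := (norm_sub_le _ _).trans (by linarith)
  have h3 : japaneseBracket z ≤ (1 + R) + ‖x - z‖ := by
    have : ‖z‖ ≤ ‖x‖ + ‖x - z‖ := by
      rw [norm_sub_rev]; exact norm_le_norm_add_norm_sub' z x
    linarith [japaneseBracket_le z]
  have h0 := norm_nonneg (x - x')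
  have ha := norm_nonneg (x - z)
  have hb := norm_nonneg (x' - z)
  calc _ ≤ ‖x - x'‖ * ((1 + R) + ‖x - z‖) := by gcongr
    _ = ‖x - x'‖ * (1 + R) + ‖x - x'‖ * ‖x - z‖ := by ring
    _ ≤ (‖x - z‖ + ‖x' - z‖) * (1 + R) + 2 * R * ‖x - z‖ := by gcongr
    _ ≤ _ := by nlinarith

/-- After the poles are separated, each piece carries `|x - z|^{-3/2} ⟨z⟩^{-1/2-2ε}`, of total order
`2 + 2ε`; this is where `ε > 0` gives convergence at infinity. Distinct poles are needed because `0
^ (-1/2)` is `0` by convention. -/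
lemma exists_lintegral_cauchyAbs_mul_cauchyAbs_le (hε : 0 < ε) (R : ℝ) :
    ∃ C : ℝ≥0∞, C ≠ ⊤ ∧ ∀ x x' : ℂ, ‖x‖ ≤ R → ‖x'‖ ≤ R → x ≠ x' →
      ∫⁻ z, cauchyAbs x z * cauchyAbs x' z ∂(weightMeasure ε) ≤
        C * ENNReal.ofReal (‖x - x'‖ ^ (-(1 / 2) : ℝ)) := by
  obtain ⟨C₀, hC₀, h⟩ := exists_lintegral_norm_sub_rpow_mul_japaneseBracket_le
    (s := 3 / 2) (t := 1 / 2 + 2 * ε) (by norm_num) (by norm_num) (by linarith)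
  refine ⟨ENNReal.ofReal ((1 + 3 * R) ^ (1 / 2 : ℝ)) * (C₀ + C₀),
    ENNReal.mul_ne_top ENNReal.ofReal_ne_top (by simp [hC₀]), fun x x' hx hx' hne => ?_⟩
  have hR : 0 ≤ R := (norm_nonneg x).trans hx
  have hd : 0 < ‖x - x'‖ := norm_pos_iff.2 (sub_ne_zero.2 hne)
  rw [lintegral_weightMeasure (by unfold cauchyAbs; fun_prop)]
  set D := (1 + 3 * R) ^ (1 / 2 : ℝ) * ‖x - x'‖ ^ (-(1 / 2) : ℝ) with hD
  have hD0 : 0 ≤ D := by positivity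
  have hpt : ∀ z : ℂ, ENNReal.ofReal (japaneseBracket z ^ (-2 * ε)) *
      (cauchyAbs x z * cauchyAbs x' z) ≤ ENNReal.ofReal D *
      (ENNReal.ofReal (‖x - z‖ ^ (-(3 / 2) : ℝ) * japaneseBracket z ^ (-(1 / 2 + 2 * ε))) +
      ENNReal.ofReal (‖x' - z‖ ^ (-(3 / 2) : ℝ) * japaneseBracket z ^ (-(1 / 2 + 2 * ε)))) := by
    intro z
    have hJ := japaneseBracket_pos z
    unfold cauchyAbs
    rw [← ENNReal.ofReal_mul (by positivity), ← ENNReal.ofReal_mul (by positivity),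
      ← ENNReal.ofReal_add (by positivity) (by positivity), ← ENNReal.ofReal_mul hD0]
    apply ENNReal.ofReal_le_ofReal
    have hk := inv_mul_inv_le_rpow (norm_nonneg (x - z)) (norm_nonneg (x' - z)) hd hJ
      (norm_sub_mul_japaneseBracket_le hx hx' z)
    calc _ ≤ _ := mul_le_mul_of_nonneg_left hk (by positivity)
      _ = D * (japaneseBracket z ^ (-2 * ε) * japaneseBracket z ^ (-(1 / 2) : ℝ)) *
        (‖x - z‖ ^ (-(3 / 2) : ℝ) + ‖x' - z‖ ^ (-(3 / 2) : ℝ)) := by rw [hD]; ring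
      _ = _ := by
        rw [← Real.rpow_add hJ, show -2 * ε + -(1 / 2) = -(1 / 2 + 2 * ε) by ring]; ring
  calc _ ≤ _ := lintegral_mono hpt
    _ = ENNReal.ofReal D * (_ + _) := by
      rw [lintegral_const_mul _ (by fun_prop), lintegral_add_left (by fun_prop)]
    _ ≤ ENNReal.ofReal D * (C₀ + C₀) := by gcongr <;> apply h
    _ = _ := by rw [hD, ENNReal.ofReal_mul (by positivity)]; ring

@[fun_prop]
lemma measurable_cauchyAbs : Measurable fun p : ℂ × ℂ => cauchyAbs p.1 p.2 := by
  unfold cauchyAbs; fun_prop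

lemma lintegral_mono_smul_measure {K : ℝ≥0∞} {m μ : Measure ℂ} (h : m ≤ K • μ) (f : ℂ → ℝ≥0∞) :
    ∫⁻ z, f z ∂m ≤ K * ∫⁻ z, f z ∂μ := by
  refine (lintegral_mono' h le_rfl).trans (le_of_eq ?_)
  rw [lintegral_smul_measure, smul_eq_mul]

end Kernels

/-! ### Potentials of sets as Schur weights -/

section SetPotential

variable {ε : ℝ}

lemma cauchyAbs_pos {x z : ℂ} (h : x ≠ z) : 0 < cauchyAbs x z := by
  have : 0 < ‖x - z‖ := norm_pos_iff.2 (sub_ne_zero.2 h)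
  simpa [cauchyAbs] using this

lemma enorm_one_div_sub (x z : ℂ) : ‖1 / (x - z)‖ₑ = cauchyAbs x z := by
  rw [cauchyAbs, ← ofReal_norm, one_div, norm_inv]

/-- The potential `∫_T |x - z|⁻¹ dx`. -/
def setPotential (T : Set ℂ) (z : ℂ) : ℝ≥0∞ := ∫⁻ x in T, cauchyAbs x z

@[fun_prop]
lemma measurable_setPotential (T : Set ℂ) : Measurable (setPotential T) :=
  Measurable.lintegral_prod_left' (f := fun p : ℂ × ℂ => cauchyAbs p.1 p.2) measurable_cauchyAbs

lemma exists_setPotential_le (R : ℝ) :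
    ∃ C : ℝ≥0∞, C ≠ ⊤ ∧ ∀ T ⊆ Metric.ball (0 : ℂ) R, ∀ z, setPotential T z ≤ C := by
  obtain ⟨C, hC, h⟩ := exists_lintegral_ball_norm_sub_rpow_le (s := 1) (by norm_num)
    (by norm_num) R
  refine ⟨C, hC, fun T hT z => (lintegral_mono_set hT).trans (le_trans (le_of_eq ?_) (h z))⟩
  simp [cauchyAbs, Real.rpow_neg_one]

lemma setPotential_ne_zero {T : Set ℂ} (hT0 : volume T ≠ 0) (z : ℂ) :
    setPotential T z ≠ 0 := by
  unfold setPotential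
  rw [Ne, lintegral_eq_zero_iff (by fun_prop)]
  intro h
  have h2 : ∀ᵐ x ∂(volume.restrict T), x ≠ z :=
    ae_restrict_of_ae (compl_mem_ae_iff.2 (measure_singleton z))
  have h3 : ∀ᵐ x ∂(volume.restrict T), False := by
    filter_upwards [h, h2] with x hx hx2
    exact (cauchyAbs_pos hx2).ne' hx
  simp only [Filter.eventually_false_iff_eq_bot, ae_eq_bot, Measure.restrict_eq_zero] at h3
  exact hT0 h3

/-- `T` has Riesz potential of order `1/2` at most `η` on `T`. -/
def HasRieszBound (T : Set ℂ) (η : ℝ≥0∞) : Prop :=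
  ∀ x ∈ T, ∫⁻ x' in T, ENNReal.ofReal (‖x - x'‖ ^ (-(1 / 2) : ℝ)) ≤ η

/-- By Tonelli the left side integrates, over `x'` in `T`, the weighted product of the kernels with
poles `x` and `x'`. The bound `|x - x'|^{-1/2}` for that product explains the order of the potential
in `HasRieszBound`. -/
lemma exists_lintegral_cauchyAbs_mul_setPotential_le (hε : 0 < ε) (R : ℝ) :
    ∃ C : ℝ≥0∞, C ≠ ⊤ ∧ ∀ T ⊆ Metric.ball (0 : ℂ) R, MeasurableSet T →
      ∀ η, HasRieszBound T η → ∀ x ∈ T,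
      ∫⁻ z, cauchyAbs x z * setPotential T z ∂(weightMeasure ε) ≤ C * η := by
  obtain ⟨C, hC, h⟩ := exists_lintegral_cauchyAbs_mul_cauchyAbs_le hε R
  refine ⟨C, hC, fun T hT hTm η hη x hx => ?_⟩
  have hR : ∀ w ∈ T, ‖w‖ ≤ R := fun w hw => (mem_ball_zero_iff.1 (hT hw)).le
  calc ∫⁻ z, cauchyAbs x z * setPotential T z ∂(weightMeasure ε)
      = ∫⁻ z, (∫⁻ x' in T, cauchyAbs x z * cauchyAbs x' z) ∂(weightMeasure ε) := by
        refine lintegral_congr fun z => ?_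
        rw [setPotential, lintegral_const_mul _ (by fun_prop)]
    _ = ∫⁻ x' in T, (∫⁻ z, cauchyAbs x z * cauchyAbs x' z ∂(weightMeasure ε)) :=
        lintegral_lintegral_swap (by fun_prop)
    _ ≤ ∫⁻ x' in T, C * ENNReal.ofReal (‖x - x'‖ ^ (-(1 / 2) : ℝ)) := by
        have h2 : ∀ᵐ x' ∂(volume.restrict T), x' ≠ x :=
          ae_restrict_of_ae (compl_mem_ae_iff.2 (measure_singleton x))
        refine lintegral_mono_ae ?_
        filter_upwards [h2, ae_restrict_mem hTm] with x' hx' hx'T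
        exact h x x' (hR x hx) (hR x' hx'T) hx'.symm
    _ = C * _ := lintegral_const_mul _ (by fun_prop)
    _ ≤ C * η := by gcongr; exact hη x hx

/-- Cauchy potentials are square integrable over sets with small Riesz potential. -/
lemma exists_setLIntegral_sq_cauchyAbs_le (hε : 0 < ε) (R : ℝ) :
    ∃ C : ℝ≥0∞, C ≠ ⊤ ∧ ∀ T ⊆ Metric.ball (0 : ℂ) R, MeasurableSet T →
      ∀ η, HasRieszBound T η → ∀ (K : ℝ≥0∞) (m : Measure ℂ) [SFinite m],
      m ≤ K • weightMeasure ε → ∀ g : ℂ → ℝ≥0∞, Measurable g →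
      ∫⁻ x in T, (∫⁻ z, cauchyAbs x z * g z ∂m) ^ 2 ≤ C * K * η * ∫⁻ z, g z ^ 2 ∂m := by
  obtain ⟨C, hC, h⟩ := exists_lintegral_cauchyAbs_mul_setPotential_le hε R
  obtain ⟨C', hC', h'⟩ := exists_setPotential_le R
  refine ⟨C, hC, fun T hT hTm η hη K m _ hm g hg => ?_⟩
  by_cases hT0 : volume T = 0
  · rw [Measure.restrict_eq_zero.2 hT0]; simp
  -- The Schur weight is the marginal of the kernel over `T`, so the second hypothesis is an
  -- equality with `c = 1`. This weight must not vanish, which is why null sets were removed first.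
  have := lintegral_sq_lintegral_le (μ := volume.restrict T) (ν := m) (k := cauchyAbs)
    measurable_cauchyAbs (measurable_setPotential T) (setPotential_ne_zero hT0)
    (fun z => ((h' T hT z).trans_lt hC'.lt_top).ne) hg (a := K * (C * η)) (c := 1)
    ((ae_restrict_mem hTm).mono fun x hx =>
      (lintegral_mono_smul_measure hm _).trans (by gcongr; exact h T hT hTm η hη x hx))
    (fun z => by rw [one_mul]; rfl)
  refine this.trans (le_of_eq (by ring))

lemma exists_hasRieszBound_ball (R : ℝ) :
    ∃ C : ℝ≥0∞, C ≠ ⊤ ∧ ∀ T ⊆ Metric.ball (0 : ℂ) R, HasRieszBound T C := by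
  obtain ⟨C, hC, h⟩ := exists_lintegral_ball_norm_sub_rpow_le (s := 1 / 2) (by norm_num)
    (by norm_num) R
  refine ⟨C, hC, fun T hT x _ => (lintegral_mono_set hT).trans (le_trans (le_of_eq ?_) (h x))⟩
  simp_rw [norm_sub_rev x]

/-- The Cauchy potential of a compactly supported density is in the weighted space. -/
lemma exists_lintegral_weightMeasure_sq_cauchyAbs_le (hε : 0 < ε) (R : ℝ) :
    ∃ C : ℝ≥0∞, C ≠ ⊤ ∧ ∀ T ⊆ Metric.ball (0 : ℂ) R, MeasurableSet T →
      ∀ g : ℂ → ℝ≥0∞, Measurable g →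
      ∫⁻ z, (∫⁻ x in T, cauchyAbs x z * g x) ^ 2 ∂(weightMeasure ε) ≤
        C * ∫⁻ x in T, g x ^ 2 := by
  obtain ⟨C, hC, h⟩ := exists_lintegral_cauchyAbs_mul_setPotential_le hε R
  obtain ⟨C', hC', h'⟩ := exists_hasRieszBound_ball R
  refine ⟨C * C', ENNReal.mul_ne_top hC hC', fun T hT hTm g hg => ?_⟩
  have := lintegral_sq_lintegral_le' (μ := volume.restrict T) (ν := weightMeasure ε)
    (k := cauchyAbs) measurable_cauchyAbs (measurable_setPotential T) hg (a := C * C') (c := 1)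
    ((ae_restrict_mem hTm).mono fun x hx => h T hT hTm C' (h' T hT) x hx)
    (fun z => by rw [one_mul]; rfl)
  simpa using this

end SetPotential

/-! ### Kernels of first and second differences -/

section Differences

variable {ε : ℝ}

/-- The kernel dominating the first difference of a Cauchy transform. -/
def diffKernel (y x z : ℂ) : ℝ≥0∞ := ENNReal.ofReal ‖y‖ * (cauchyAbs x z * cauchyAbs (x + y) z)

/-- The kernel dominating the second difference of a Cauchy transform. -/
def secondDiffKernel (y x z : ℂ) : ℝ≥0∞ :=
  ENNReal.ofReal (2 * ‖y‖ ^ 2) * (cauchyAbs x z * cauchyAbs (x + y) z * cauchyAbs (x - y) z)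

@[fun_prop]
lemma measurable_diffKernel (y : ℂ) : Measurable fun p : ℂ × ℂ => diffKernel y p.1 p.2 := by
  unfold diffKernel cauchyAbs; fun_prop

@[fun_prop]
lemma measurable_secondDiffKernel (y : ℂ) :
    Measurable fun p : ℂ × ℂ => secondDiffKernel y p.1 p.2 := by
  unfold secondDiffKernel cauchyAbs; fun_prop

lemma ofReal_mul_ofReal_rpow_neg_half {d : ℝ} (hd : 0 < d) :
    ENNReal.ofReal d * ENNReal.ofReal (d ^ (-(1 / 2) : ℝ)) = ENNReal.ofReal (d ^ (1 / 2 : ℝ)) := by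
  rw [← ENNReal.ofReal_mul hd.le]
  congr 1
  nth_rw 1 [← Real.rpow_one d]
  rw [← Real.rpow_add hd]
  norm_num

/-- Both marginals are `O(|y|^{1/2})`: the factor `|y|` meets the `|y|^{-1/2}` coming from two poles
at distance `|y|`. Schur's test with constant weight multiplies the two bounds. The full kernel `|y|
/ (|ζ| |ζ + y|)` has a logarithmically divergent integral at infinity, so the weight `m` and the
boundedness of `T` are needed here. -/
lemma exists_setLIntegral_sq_diffKernel_le (hε : 0 < ε) (R : ℝ) :
    ∃ C : ℝ≥0∞, C ≠ ⊤ ∧ ∀ T ⊆ Metric.ball (0 : ℂ) R, MeasurableSet T →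
      ∀ y : ℂ, y ≠ 0 → ‖y‖ ≤ 1 → ∀ (K : ℝ≥0∞) (m : Measure ℂ) [SFinite m],
      m ≤ K • weightMeasure ε → ∀ g : ℂ → ℝ≥0∞, Measurable g →
      ∫⁻ x in T, (∫⁻ z, diffKernel y x z * g z ∂m) ^ 2 ≤
        C * K * ENNReal.ofReal ‖y‖ * ∫⁻ z, g z ^ 2 ∂m := by
  obtain ⟨C₁, hC₁, h₁⟩ := exists_lintegral_cauchyAbs_mul_cauchyAbs_le hε (R + 1)
  obtain ⟨C₂, hC₂, h₂⟩ := exists_lintegral_ball_norm_sub_rpow_le (s := 3 / 2) (by norm_num)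
    (by norm_num) (R + 1)
  set D := ENNReal.ofReal ((1 + 3 * (R + 1)) ^ (1 / 2 : ℝ)) * (C₂ + C₂) with hD
  have hDt : D ≠ ⊤ := ENNReal.mul_ne_top ENNReal.ofReal_ne_top (by simp [hC₂])
  refine ⟨C₁ * D, ENNReal.mul_ne_top hC₁ hDt, fun T hT hTm y hy hy1 K m _ hm g hg => ?_⟩
  have hy0 : 0 < ‖y‖ := norm_pos_iff.2 hy
  have hTR : ∀ x ∈ T, ‖x‖ ≤ R + 1 ∧ ‖x + y‖ < R + 1 := fun x hx => by
    have := mem_ball_zero_iff.1 (hT hx)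
    exact ⟨by linarith, (norm_add_le _ _).trans_lt (by linarith)⟩
  have hH : ENNReal.ofReal (‖y‖ ^ (1 / 2 : ℝ)) * ENNReal.ofReal (‖y‖ ^ (1 / 2 : ℝ)) =
      ENNReal.ofReal ‖y‖ := by
    rw [← ENNReal.ofReal_mul (by positivity), ← Real.rpow_add hy0]
    norm_num
  have hA : ∀ x ∈ T, ∫⁻ z, diffKernel y x z * 1 ∂m ≤
      K * (C₁ * ENNReal.ofReal (‖y‖ ^ (1 / 2 : ℝ))) := fun x hx => by
    refine (lintegral_mono_smul_measure hm _).trans ?_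
    gcongr
    simp only [mul_one, diffKernel]
    rw [lintegral_const_mul _ (by fun_prop)]
    have := h₁ x (x + y) (hTR x hx).1 (hTR x hx).2.le (by simpa using hy)
    simp only [sub_add_cancel_left, norm_neg] at this
    calc _ ≤ ENNReal.ofReal ‖y‖ * (C₁ * ENNReal.ofReal (‖y‖ ^ (-(1 / 2) : ℝ))) := by gcongr
      _ = C₁ * (ENNReal.ofReal ‖y‖ * ENNReal.ofReal (‖y‖ ^ (-(1 / 2) : ℝ))) := by ring
      _ = _ := by rw [ofReal_mul_ofReal_rpow_neg_half hy0]
  have hB : ∀ z, ∫⁻ x in T, diffKernel y x z ≤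
      D * ENNReal.ofReal (‖y‖ ^ (1 / 2 : ℝ)) * 1 := fun z => by
    have hJ := japaneseBracket_pos z
    have hpt : ∀ x ∈ T, cauchyAbs x z * cauchyAbs (x + y) z ≤
        ENNReal.ofReal ((1 + 3 * (R + 1)) ^ (1 / 2 : ℝ)) *
          ENNReal.ofReal (‖y‖ ^ (-(1 / 2) : ℝ)) *
        ((ENNReal.ofReal (‖x - z‖ ^ (-(3 / 2) : ℝ))) +
          (ENNReal.ofReal (‖x + y - z‖ ^ (-(3 / 2) : ℝ)))) := fun x hx => by
      have hR : 0 ≤ R + 1 := (norm_nonneg x).trans (hTR x hx).1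
      have hb := norm_sub_mul_japaneseBracket_le (hTR x hx).1 (hTR x hx).2.le z
      simp only [sub_add_cancel_left, norm_neg] at hb
      have hk := inv_mul_inv_le_rpow (norm_nonneg (x - z)) (norm_nonneg (x + y - z)) hy0 hJ hb
      unfold cauchyAbs
      rw [← ENNReal.ofReal_mul (by positivity), ← ENNReal.ofReal_mul (by positivity),
        ← ENNReal.ofReal_add (by positivity) (by positivity), ← ENNReal.ofReal_mul (by positivity)]
      apply ENNReal.ofReal_le_ofReal
      refine hk.trans ?_
      gcongr
      exact mul_le_of_le_one_left (by positivity)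
        (Real.rpow_le_one_of_one_le_of_nonpos (one_le_japaneseBracket z) (by norm_num))
    have hs1 : ∫⁻ x in T, ENNReal.ofReal (‖x - z‖ ^ (-(3 / 2) : ℝ)) ≤ C₂ :=
      (lintegral_mono_set fun x hx => mem_ball_zero_iff.2
        ((mem_ball_zero_iff.1 (hT hx)).trans (by linarith))).trans (h₂ z)
    have hs2 : ∫⁻ x in T, ENNReal.ofReal (‖x + y - z‖ ^ (-(3 / 2) : ℝ)) ≤ C₂ := by
      refine le_trans ?_ (h₂ z)
      rw [← lintegral_indicator hTm, ← lintegral_indicator measurableSet_ball,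
        ← lintegral_add_right_eq_self (μ := volume)
          ((Metric.ball (0 : ℂ) (R + 1)).indicator _) y]
      refine lintegral_mono fun x => ?_
      by_cases hx : x ∈ T
      · rw [indicator_of_mem hx, indicator_of_mem (mem_ball_zero_iff.2 (hTR x hx).2)]
      · rw [indicator_of_notMem hx]; exact zero_le
    simp only [diffKernel]
    rw [lintegral_const_mul _ (by fun_prop)]
    calc _ ≤ ENNReal.ofReal ‖y‖ * ∫⁻ x in T,
          ENNReal.ofReal ((1 + 3 * (R + 1)) ^ (1 / 2 : ℝ)) *
          ENNReal.ofReal (‖y‖ ^ (-(1 / 2) : ℝ)) *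
          ((ENNReal.ofReal (‖x - z‖ ^ (-(3 / 2) : ℝ))) +
          (ENNReal.ofReal (‖x + y - z‖ ^ (-(3 / 2) : ℝ)))) := by
          gcongr 1
          exact setLIntegral_mono (by fun_prop) hpt
      _ ≤ ENNReal.ofReal ‖y‖ * (ENNReal.ofReal ((1 + 3 * (R + 1)) ^ (1 / 2 : ℝ)) *
          ENNReal.ofReal (‖y‖ ^ (-(1 / 2) : ℝ)) * (C₂ + C₂)) := by
          rw [lintegral_const_mul _ (by fun_prop), lintegral_add_left (by fun_prop)]
          gcongr
      _ = D * (ENNReal.ofReal ‖y‖ * ENNReal.ofReal (‖y‖ ^ (-(1 / 2) : ℝ))) := by rw [hD]; ring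
      _ = _ := by rw [ofReal_mul_ofReal_rpow_neg_half hy0, mul_one]
  refine (lintegral_sq_lintegral_le (μ := volume.restrict T) (ν := m) (k := diffKernel y)
    (by fun_prop) (measurable_const (a := (1 : ℝ≥0∞))) (by simp) (by simp) hg
    ((ae_restrict_mem hTm).mono hA) hB).trans (le_of_eq ?_)
  rw [← hH]
  ring

end Differences

/-! ### Scaling and the second-difference kernel -/

section Scaling

lemma lintegral_circle_mul (c : Circle) (f : ℂ → ℝ≥0∞) :
    ∫⁻ z : ℂ, f (c * z) = ∫⁻ z, f z := by
  have h := (rotation c).measurePreserving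
  exact h.lintegral_comp_emb (rotation c).toHomeomorph.measurableEmbedding f

lemma lintegral_real_mul {t : ℝ} (ht : 0 < t) (f : ℂ → ℝ≥0∞) :
    ENNReal.ofReal (t ^ 2) * ∫⁻ z : ℂ, f (t * z) = ∫⁻ z, f z := by
  have he : MeasurableEmbedding fun z : ℂ => t • z :=
    (Homeomorph.smulOfNeZero t ht.ne').measurableEmbedding
  have h := Measure.map_addHaar_smul (volume : Measure ℂ) ht.ne'
  have h2 : ∫⁻ z : ℂ, f (t * z) = ENNReal.ofReal ((t ^ 2)⁻¹) * ∫⁻ z, f z := by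
    have h3 := he.lintegral_map (μ := volume) f
    rw [h, lintegral_smul_measure, Complex.finrank_real_complex, abs_of_pos (by positivity)] at h3
    rw [← smul_eq_mul, h3]
    simp
  rw [h2, ← mul_assoc, ← ENNReal.ofReal_mul (by positivity), mul_inv_cancel₀ (by positivity)]
  simp

lemma lintegral_complex_mul {y : ℂ} (hy : y ≠ 0) (f : ℂ → ℝ≥0∞) :
    ENNReal.ofReal (‖y‖ ^ 2) * ∫⁻ z : ℂ, f (y * z) = ∫⁻ z, f z := by
  have hy0 : 0 < ‖y‖ := norm_pos_iff.2 hy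
  let c : Circle := ⟨y / ‖y‖, by simp [Submonoid.unitSphere, hy]⟩
  rw [← lintegral_circle_mul c f, ← lintegral_real_mul hy0 (fun z => f (c * z))]
  congr 1
  refine lintegral_congr fun z => ?_
  congr 1
  rw [← mul_assoc]
  congr 1
  change y = y / ‖y‖ * ‖y‖
  rw [div_mul_cancel₀]
  exact_mod_cast hy0.ne'

/-- The poles `1` and `-1` are separated at the cost of `2⟨z⟩⁻¹`; then `0` is separated from each of
them by `inv_mul_inv_le_rpow`. What remains is a sum of terms `|x - z|^{-3/2} ⟨z⟩^{-3/2}`, of total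
order `3 > 2`. -/
lemma lintegral_inv_norm_mul_lt_top :
    ∫⁻ z : ℂ, ENNReal.ofReal (‖z‖⁻¹ * ‖z + 1‖⁻¹ * ‖z - 1‖⁻¹) < ⊤ := by
  obtain ⟨C, hC, h⟩ := exists_lintegral_norm_sub_rpow_mul_japaneseBracket_le
    (s := 3 / 2) (t := 3 / 2) (by norm_num) (by norm_num) (by norm_num)
  set F : ℂ → ℂ → ℝ := fun x z => ‖x - z‖ ^ (-(3 / 2) : ℝ) * japaneseBracket z ^ (-(3 / 2) : ℝ)
    with hF
  have hF0 : ∀ x z, 0 ≤ F x z := fun x z => by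
    have := japaneseBracket_pos z
    rw [hF]; positivity
  have hpt : ∀ z : ℂ, ENNReal.ofReal (‖z‖⁻¹ * ‖z + 1‖⁻¹ * ‖z - 1‖⁻¹) ≤
      ENNReal.ofReal (2 * 4 ^ (1 / 2 : ℝ)) *
        ((ENNReal.ofReal (F 0 z) + ENNReal.ofReal (F (-1) z)) +
          (ENNReal.ofReal (F 0 z) + ENNReal.ofReal (F 1 z))) := by
    intro z
    have hJ := japaneseBracket_pos z
    rw [← ENNReal.ofReal_add (hF0 _ _) (hF0 _ _), ← ENNReal.ofReal_add (hF0 _ _) (hF0 _ _),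
      ← ENNReal.ofReal_add (add_nonneg (hF0 _ _) (hF0 _ _)) (add_nonneg (hF0 _ _) (hF0 _ _)),
      ← ENNReal.ofReal_mul (by positivity)]
    apply ENNReal.ofReal_le_ofReal
    have ea : ‖z‖ = ‖0 - z‖ := by simp
    have eb : ‖z + 1‖ = ‖-1 - z‖ := by rw [← norm_neg]; congr 1; ring
    have ec : ‖z - 1‖ = ‖1 - z‖ := norm_sub_rev _ _
    rw [ea, eb, ec]
    have h1 := inv_mul_inv_le_rpow (norm_nonneg (0 - z)) (norm_nonneg (-1 - z))
      (d := ‖(0 : ℂ) - (-1)‖) (by simp) hJ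
      (norm_sub_mul_japaneseBracket_le (R := 1) (by simp) (by simp) z)
    have h2 := inv_mul_inv_le_rpow (norm_nonneg (0 - z)) (norm_nonneg (1 - z))
      (d := ‖(0 : ℂ) - 1‖) (by simp) hJ
      (norm_sub_mul_japaneseBracket_le (R := 1) (by simp) (by simp) z)
    have h3 := norm_sub_mul_japaneseBracket_le (R := 1) (x := 1) (x' := -1) (by simp) (by simp) z
    have hpow : japaneseBracket z ^ (-(3 / 2) : ℝ) =
        (japaneseBracket z)⁻¹ * japaneseBracket z ^ (-(1 / 2) : ℝ) := by
      rw [← Real.rpow_neg_one, ← Real.rpow_add hJ]; norm_num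
    have e4 : (1 : ℝ) + 3 * 1 = 4 := by norm_num
    have e2 : ‖(1 : ℂ) - (-1)‖ = 2 := by norm_num
    simp only [sub_neg_eq_add, zero_add, norm_one, Real.one_rpow, mul_one, zero_sub, norm_neg,
      ] at h1 h2
    rw [e2, e4] at h3
    rw [show (1 : ℝ) + 3 = 4 by norm_num] at h1 h2
    simp only [hF, hpow, zero_sub, norm_neg]
    generalize ‖z‖ = a at *
    have hb := norm_nonneg (-1 - z)
    have hc := norm_nonneg (1 - z)
    generalize ‖-1 - z‖ = b at *
    generalize ‖1 - z‖ = c at *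
    generalize japaneseBracket z ^ (-(1 / 2) : ℝ) = w at *
    generalize japaneseBracket z = J at *
    generalize a ^ (-(3 / 2) : ℝ) = a' at *
    generalize b ^ (-(3 / 2) : ℝ) = b' at *
    generalize c ^ (-(3 / 2) : ℝ) = c' at *
    have ha : 0 ≤ a := by simp_all
    have hbc : b⁻¹ * c⁻¹ ≤ 2 * J⁻¹ * (b⁻¹ + c⁻¹) := by
      rcases hb.eq_or_lt with rfl | hb
      · simp only [inv_zero, zero_mul]; positivity
      rcases hc.eq_or_lt with rfl | hc
      · simp only [inv_zero, mul_zero]; positivity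
      have e1 : b⁻¹ * c⁻¹ = J / (J * b * c) := by field_simp
      have e2 : 2 * J⁻¹ * (b⁻¹ + c⁻¹) = (2 * (b + c)) / (J * b * c) := by field_simp; ring
      rw [e1, e2]
      gcongr
      linarith
    have ha' : 0 ≤ a⁻¹ := by positivity
    calc a⁻¹ * b⁻¹ * c⁻¹ = a⁻¹ * (b⁻¹ * c⁻¹) := by ring
      _ ≤ a⁻¹ * (2 * J⁻¹ * (b⁻¹ + c⁻¹)) := by gcongr
      _ = 2 * J⁻¹ * (a⁻¹ * b⁻¹ + a⁻¹ * c⁻¹) := by ring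
      _ ≤ 2 * J⁻¹ * (4 ^ (1 / 2 : ℝ) * (w * (a' + b')) + 4 ^ (1 / 2 : ℝ) * (w * (a' + c'))) := by
          gcongr
      _ = _ := by ring
  refine (lintegral_mono hpt).trans_lt ?_
  rw [lintegral_const_mul _ (by fun_prop), lintegral_add_left (by fun_prop),
    lintegral_add_left (by fun_prop), lintegral_add_left (by fun_prop)]
  refine ENNReal.mul_lt_top ENNReal.ofReal_lt_top ?_
  have := fun x => (h x).trans_lt hC.lt_top
  simp only [ENNReal.add_lt_top]
  exact ⟨⟨this 0, this (-1)⟩, this 0, this 1⟩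

/-- The kernel depends only on `x - z` and decays cubically, so its integral over the plane is
finite. The substitution `ζ = y z` shows that integral to be proportional to `|y|`, and Schur's test
with constant weight squares it. -/
lemma exists_setLIntegral_sq_secondDiffKernel_le {ε : ℝ} (hε : 0 ≤ ε) :
    ∃ C : ℝ≥0∞, C ≠ ⊤ ∧ ∀ T : Set ℂ, ∀ y : ℂ, y ≠ 0 →
      ∀ (K : ℝ≥0∞) (m : Measure ℂ) [SFinite m],
      m ≤ K • weightMeasure ε → ∀ g : ℂ → ℝ≥0∞, Measurable g →
      ∫⁻ x in T, (∫⁻ z, secondDiffKernel y x z * g z ∂m) ^ 2 ≤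
        C * K * ENNReal.ofReal (‖y‖ ^ 2) * ∫⁻ z, g z ^ 2 ∂m := by
  set I := ∫⁻ z : ℂ, ENNReal.ofReal (‖z‖⁻¹ * ‖z + 1‖⁻¹ * ‖z - 1‖⁻¹) with hI
  refine ⟨4 * I ^ 2, ENNReal.mul_ne_top (by simp)
    (ENNReal.pow_ne_top lintegral_inv_norm_mul_lt_top.ne), fun T y hy K m _ hm g hg => ?_⟩
  have hy0 : 0 < ‖y‖ := norm_pos_iff.2 hy
  set G : ℂ → ℝ≥0∞ := fun ζ => ENNReal.ofReal (2 * ‖y‖ ^ 2 * (‖ζ‖⁻¹ * ‖ζ + y‖⁻¹ * ‖ζ - y‖⁻¹))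
    with hG
  have hk : ∀ x z, secondDiffKernel y x z = G (x - z) := fun x z => by
    simp only [secondDiffKernel, cauchyAbs, hG]
    rw [← ENNReal.ofReal_mul (by positivity), ← ENNReal.ofReal_mul (by positivity),
      ← ENNReal.ofReal_mul (by positivity), show x - z + y = x + y - z by ring,
      show x - z - y = x - y - z by ring]
  have hGI : ∫⁻ ζ, G ζ = ENNReal.ofReal (2 * ‖y‖) * I := by
    rw [← lintegral_complex_mul hy, hI, ← lintegral_const_mul _ (by fun_prop),
      ← lintegral_const_mul _ (by fun_prop)]
    refine lintegral_congr fun z => ?_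
    rw [hG, ← ENNReal.ofReal_mul (by positivity), ← ENNReal.ofReal_mul (by positivity)]
    congr 1
    have e1 : y * z + y = y * (z + 1) := by ring
    have e2 : y * z - y = y * (z - 1) := by ring
    rw [e1, e2]
    simp only [norm_mul, mul_inv]
    field_simp
  have hA : ∀ x, ∫⁻ z, secondDiffKernel y x z * 1 ∂m ≤ K * (ENNReal.ofReal (2 * ‖y‖) * I) :=
    fun x => by
    refine (lintegral_mono_smul_measure hm _).trans ?_
    gcongr
    refine (lintegral_mono' (weightMeasure_le_volume hε) le_rfl).trans ?_
    simp only [mul_one, hk]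
    rw [lintegral_sub_left_eq_self G x, hGI]
  have hB : ∀ z, ∫⁻ x in T, secondDiffKernel y x z ≤ ENNReal.ofReal (2 * ‖y‖) * I * 1 :=
    fun z => by
    refine (setLIntegral_le_lintegral _ _).trans ?_
    simp only [mul_one, hk]
    rw [lintegral_sub_right_eq_self G z, hGI]
  refine (lintegral_sq_lintegral_le (μ := volume.restrict T) (ν := m) (k := secondDiffKernel y)
    (by fun_prop) (measurable_const (a := (1 : ℝ≥0∞))) (by simp) (by simp) hg
    (Filter.Eventually.of_forall hA) hB).trans (le_of_eq ?_)
  rw [ENNReal.ofReal_mul (by norm_num), ENNReal.ofReal_pow (norm_nonneg y)]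
  simp only [ENNReal.ofReal_ofNat]
  ring

end Scaling

/-! ### Boundary strips of convex sets -/

section Strip

/-- The points which exactly one of `Ω` and `Ω - y` contains. -/
def stripSet (Ω : Set ℂ) (y : ℂ) : Set ℂ := {x | ¬(x ∈ Ω ↔ x + y ∈ Ω)}

lemma measurableSet_stripSet {Ω : Set ℂ} (hΩ : MeasurableSet Ω) (y : ℂ) :
    MeasurableSet (stripSet Ω y) :=
  (hΩ.mem.iff (hΩ.mem.comp (measurable_add_const y))).not.setOf

/-- A point leaving `I` under translation by `t` lies within `t` of the supremum, and a point
entering `I` lies in an interval of length `t` ending at the infimum. -/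
lemma volume_interval_symmDiff_le {I : Set ℝ} (hI : I.OrdConnected) {t : ℝ}
    (ht : 0 ≤ t) (hbd : Bornology.IsBounded I) :
    volume {r : ℝ | ¬(r ∈ I ↔ r + t ∈ I)} ≤ ENNReal.ofReal (2 * t) := by
  have hsub : {r : ℝ | ¬(r ∈ I ↔ r + t ∈ I)} ⊆
      Icc (sSup I - t) (sSup I) ∪ Icc (sInf I - t) (sInf I) := by
    intro r hr
    by_cases h1 : r ∈ I
    · have h2 : r + t ∉ I := fun h => hr (by simp [h1, h])
      left
      refine ⟨?_, le_csSup hbd.bddAbove h1⟩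
      have : sSup I ≤ r + t := csSup_le ⟨r, h1⟩ fun s hs => by
        by_contra hlt
        exact h2 (hI.out h1 hs ⟨by linarith, by linarith⟩)
      linarith
    · have h2 : r + t ∈ I := by
        by_contra h; exact hr (by simp [h1, h])
      right
      refine ⟨by linarith [csInf_le hbd.bddBelow h2], ?_⟩
      refine le_csInf ⟨_, h2⟩ fun s hs => ?_
      by_contra hlt
      exact h1 (hI.out hs h2 ⟨by linarith, by linarith⟩)
  calc _ ≤ _ := measure_mono hsub
    _ ≤ _ := measure_union_le _ _
    _ = _ := by
      rw [Real.volume_Icc, Real.volume_Icc, ← ENNReal.ofReal_add (by linarith) (by linarith)]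
      congr 1; ring

lemma exists_lintegral_Ioo_rpow_le (R : ℝ) :
    ∃ C : ℝ≥0∞, C ≠ ⊤ ∧ ∀ c : ℝ,
      ∫⁻ s in Ioo (-R) R, ENNReal.ofReal (|c - s| ^ (-(1 / 2) : ℝ)) ≤ C := by
  have hI : ∫⁻ s in Metric.ball (0 : ℝ) 1, ENNReal.ofReal (|s| ^ (-(1 / 2) : ℝ)) < ⊤ := by
    have h : IntegrableOn (fun x : ℝ => ‖x‖ ^ (-(1 / 2) : ℝ)) (Metric.ball 0 1) := by
      refine (integrableOn_fun_norm_addHaar (volume : Measure ℝ)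
        (f := fun r : ℝ => r ^ (-(1 / 2) : ℝ)) (r := 1)).2 ?_
      simpa using (intervalIntegral.integrableOn_Ioo_rpow_iff (s := -(1 / 2)) (t := 1)
        (by norm_num)).2 (by norm_num)
    simpa using h.lintegral_lt_top
  refine ⟨(∫⁻ s in Metric.ball (0 : ℝ) 1, ENNReal.ofReal (|s| ^ (-(1 / 2) : ℝ))) +
    volume (Ioo (-R) R), ENNReal.add_ne_top.2 ⟨hI.ne, by simp⟩, fun c => ?_⟩
  set f : ℝ → ℝ≥0∞ := (Metric.ball (0 : ℝ) 1).indicator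
    (fun s => ENNReal.ofReal (|s| ^ (-(1 / 2) : ℝ))) with hf
  have hpt : ∀ s : ℝ, ENNReal.ofReal (|c - s| ^ (-(1 / 2) : ℝ)) ≤ f (c - s) + 1 := by
    intro s
    by_cases hx : c - s ∈ Metric.ball (0 : ℝ) 1
    · rw [hf, indicator_of_mem hx]; exact le_self_add
    · rw [hf, indicator_of_notMem hx, zero_add, ENNReal.ofReal_le_one]
      have : 1 ≤ |c - s| := by simpa using hx
      exact Real.rpow_le_one_of_one_le_of_nonpos this (by norm_num)
  refine (lintegral_mono hpt).trans ?_
  rw [lintegral_add_right _ measurable_const, setLIntegral_const, one_mul]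
  refine add_le_add_left ((setLIntegral_le_lintegral _ _).trans ?_) _
  rw [lintegral_sub_left_eq_self f c, hf, lintegral_indicator measurableSet_ball]

/-- The translation is horizontal, so Fubini over horizontal lines is used. A convex set meets each
line in an interval, so each slice of the strip has length at most `2t`. Bounding `|x - x'|` below
by the difference of imaginary parts leaves a one-dimensional integral with exponent `1/2 < 1`. -/
lemma exists_lintegral_stripSet_ofReal_le (R : ℝ) :
    ∃ C : ℝ≥0∞, C ≠ ⊤ ∧ ∀ Ω ⊆ Metric.ball (0 : ℂ) R, Convex ℝ Ω → MeasurableSet Ω →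
      ∀ t : ℝ, 0 ≤ t → ∀ x : ℂ,
      ∫⁻ x' in stripSet Ω t, ENNReal.ofReal (‖x - x'‖ ^ (-(1 / 2) : ℝ)) ≤
        C * ENNReal.ofReal t := by
  obtain ⟨C, hC, h⟩ := exists_lintegral_Ioo_rpow_le R
  refine ⟨2 * C, ENNReal.mul_ne_top (by simp) hC, fun Ω hΩ hconv hm t ht x => ?_⟩
  have hS := measurableSet_stripSet hm t
  have hmeas : Measurable ((stripSet Ω t).indicator
      (fun x' : ℂ => ENNReal.ofReal (‖x - x'‖ ^ (-(1 / 2) : ℝ)))) :=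
    Measurable.indicator (by fun_prop) hS
  have hconv' : ∀ s : ℝ, {r : ℝ | Complex.mk r s ∈ Ω}.OrdConnected := by
    intro s
    refine Convex.ordConnected ?_
    intro a ha b hb p q hp hq hpq
    have := hconv ha hb hp hq hpq
    simp only [mem_ofPred_eq] at *
    convert this using 1
    apply Complex.ext
    · simp
    · simp [← add_mul, hpq]
  have hbd : ∀ s : ℝ, Bornology.IsBounded {r : ℝ | Complex.mk r s ∈ Ω} := by
    intro s
    refine (Metric.isBounded_ball (x := (0 : ℝ)) (r := R)).subset fun r hr => ?_
    have h1 := mem_ball_zero_iff.1 (hΩ hr)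
    exact mem_ball_zero_iff.2 ((Complex.abs_re_le_norm ⟨r, s⟩).trans_lt h1)
  rw [← lintegral_indicator hS, ← Complex.volume_preserving_equiv_real_prod.symm.lintegral_comp_emb
    Complex.measurableEquivRealProd.symm.measurableEmbedding, Measure.volume_eq_prod,
    lintegral_prod_symm (fun a => (stripSet Ω t).indicator
      (fun x' : ℂ => ENNReal.ofReal (‖x - x'‖ ^ (-(1 / 2) : ℝ)))
        (Complex.measurableEquivRealProd.symm a))
      (hmeas.comp Complex.measurableEquivRealProd.symm.measurable).aemeasurable]
  -- The line through `x` is excluded: there the majorant is `0 ^ (-1/2) = 0` by convention, so the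
  -- bound would fail, but only on a null set.
  have hpt : ∀ r s : ℝ, s ≠ x.im → (stripSet Ω t).indicator
      (fun x' : ℂ => ENNReal.ofReal (‖x - x'‖ ^ (-(1 / 2) : ℝ)))
        (Complex.measurableEquivRealProd.symm (r, s)) ≤
      {r : ℝ | ¬(r ∈ {r : ℝ | Complex.mk r s ∈ Ω} ↔ r + t ∈ {r : ℝ | Complex.mk r s ∈ Ω})}.indicator
        (fun _ => (Ioo (-R) R).indicator
          (fun s => ENNReal.ofReal (|x.im - s| ^ (-(1 / 2) : ℝ))) s) r := by
    intro r s hs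
    by_cases hz : Complex.mk r s ∈ stripSet Ω t
    · have e : Complex.mk r s + t = Complex.mk (r + t) s := Complex.ext (by simp) (by simp)
      have hz' := hz
      simp only [stripSet, mem_ofPred_eq, e] at hz'
      have him : ∀ r', Complex.mk r' s ∈ Ω → s ∈ Ioo (-R) R := fun r' hr' =>
        abs_lt.1 ((Complex.abs_im_le_norm ⟨r', s⟩).trans_lt (mem_ball_zero_iff.1 (hΩ hr')))
      have hsR : s ∈ Ioo (-R) R := by
        by_cases h1 : Complex.mk r s ∈ Ω
        · exact him _ h1
        · exact him (r + t) (by by_contra h2; exact hz' (by simp [h1, h2]))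
      rw [indicator_of_mem (show r ∈ {r : ℝ | ¬(r ∈ {r : ℝ | Complex.mk r s ∈ Ω} ↔
        r + t ∈ {r : ℝ | Complex.mk r s ∈ Ω})} from hz'), indicator_of_mem hsR]
      refine (indicator_le_self' (fun _ _ => zero_le) _).trans ?_
      apply ENNReal.ofReal_le_ofReal
      refine Real.rpow_le_rpow_of_nonpos (abs_pos.2 (sub_ne_zero.2 hs.symm)) ?_ (by norm_num)
      simpa using Complex.abs_im_le_norm (x - Complex.measurableEquivRealProd.symm (r, s))
    · exact (indicator_of_notMem hz _).trans_le zero_le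
  calc _ ≤ ∫⁻ s : ℝ, (Ioo (-R) R).indicator
          (fun s => ENNReal.ofReal (|x.im - s| ^ (-(1 / 2) : ℝ))) s * ENNReal.ofReal (2 * t) := by
        have hne : ∀ᵐ s : ℝ, s ≠ x.im := compl_mem_ae_iff.2 (measure_singleton _)
        refine lintegral_mono_ae (hne.mono fun s hs => (lintegral_mono fun r => hpt r s hs).trans ?_)
        refine (lintegral_indicator_const_le _ _).trans ?_
        gcongr
        exact volume_interval_symmDiff_le (hconv' s) ht (hbd s)
    _ ≤ C * ENNReal.ofReal (2 * t) := by
        rw [lintegral_mul_const _ (Measurable.indicator (by fun_prop) measurableSet_Ioo),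
          lintegral_indicator measurableSet_Ioo]
        gcongr
        exact h _
    _ = _ := by rw [ENNReal.ofReal_mul (by norm_num)]; simp; ring

/-- A rotation taking `|y|` to `y` reduces to the horizontal case; the class of convex subsets of
the disc is rotation invariant, so the constant is uniform. -/
lemma exists_hasRieszBound_stripSet (R : ℝ) :
    ∃ C : ℝ≥0∞, C ≠ ⊤ ∧ ∀ Ω ⊆ Metric.ball (0 : ℂ) R, Convex ℝ Ω → MeasurableSet Ω →
      ∀ y : ℂ, HasRieszBound (stripSet Ω y) (C * ENNReal.ofReal ‖y‖) := by
  obtain ⟨C, hC, h⟩ := exists_lintegral_stripSet_ofReal_le R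
  refine ⟨C, hC, fun Ω hΩ hconv hm y x _ => ?_⟩
  obtain ⟨c, hc⟩ : ∃ c : Circle, (c : ℂ) * ‖y‖ = y := by
    by_cases hy : y = 0
    · exact ⟨1, by simp [hy]⟩
    · refine ⟨⟨y / ‖y‖, by simp [Submonoid.unitSphere, hy]⟩, ?_⟩
      change y / ‖y‖ * ‖y‖ = y
      exact div_mul_cancel₀ _ (by exact_mod_cast norm_ne_zero_iff.2 hy)
  have hcn : ‖(c : ℂ)‖ = 1 := Circle.norm_coe c
  set Ω' : Set ℂ := (fun z => (c : ℂ) * z) ⁻¹' Ω with hΩ'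
  have h1 : Ω' ⊆ Metric.ball (0 : ℂ) R := fun z hz => by
    have := mem_ball_zero_iff.1 (hΩ hz)
    rw [mem_ball_zero_iff]
    simpa [hcn] using this
  have h2 : Convex ℝ Ω' := hconv.linear_preimage (LinearMap.mulLeft ℝ (c : ℂ))
  have h3 : MeasurableSet Ω' := (measurable_const_mul (c : ℂ)) hm
  have h4 := h Ω' h1 h2 h3 ‖y‖ (norm_nonneg y) ((c : ℂ)⁻¹ * x)
  refine le_trans (le_of_eq ?_) h4
  rw [← lintegral_indicator (measurableSet_stripSet hm y),
    ← lintegral_indicator (measurableSet_stripSet h3 _), ← lintegral_circle_mul c]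
  refine lintegral_congr fun z => ?_
  have hmem : (c : ℂ) * z ∈ stripSet Ω y ↔ z ∈ stripSet Ω' (‖y‖ : ℂ) := by
    simp only [stripSet, hΩ', mem_ofPred_eq, mem_preimage, mul_add, hc]
  by_cases hz : z ∈ stripSet Ω' (‖y‖ : ℂ)
  · rw [indicator_of_mem hz, indicator_of_mem (hmem.2 hz)]
    have : x - c * z = c * ((c : ℂ)⁻¹ * x - z) := by
      rw [mul_sub, mul_inv_cancel_left₀ (Circle.coe_ne_zero c)]
    rw [this, norm_mul, hcn, one_mul]
  · rw [indicator_of_notMem hz, indicator_of_notMem (fun hh => hz (hmem.1 hh))]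

end Strip

/-! ### Gain from oscillation by second differences -/

section Pairing

/-- The bounds on a function and its differences with step `y` which give the gain of one power
of `y` in oscillatory integrals over `Ω`. -/
structure HasStripEstimates (Ω : Set ℂ) (y : ℂ) (N : ℝ≥0∞) (v : ℂ → ℂ) : Prop where
  measurable : Measurable v
  sq : ∫⁻ x in Ω, ‖v x‖ₑ ^ 2 ≤ N ^ 2
  strip : ∫⁻ x in stripSet Ω y, ‖v x‖ₑ ^ 2 ≤ (‖y‖ₑ ^ (1 / 2 : ℝ) * N) ^ 2
  strip_neg : ∫⁻ x in stripSet Ω (-y), ‖v x‖ₑ ^ 2 ≤ (‖y‖ₑ ^ (1 / 2 : ℝ) * N) ^ 2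
  diff : ∫⁻ x in Ω, ‖v x - v (x + y)‖ₑ ^ 2 ≤ (‖y‖ₑ ^ (1 / 2 : ℝ) * N) ^ 2
  diff_neg : ∫⁻ x in Ω, ‖v x - v (x - y)‖ₑ ^ 2 ≤ (‖y‖ₑ ^ (1 / 2 : ℝ) * N) ^ 2
  second_diff : ∫⁻ x in Ω, ‖2 * v x - v (x + y) - v (x - y)‖ₑ ^ 2 ≤ (‖y‖ₑ * N) ^ 2

variable {Ω : Set ℂ} {y : ℂ} {N M : ℝ≥0∞} {v w e : ℂ → ℂ}

lemma HasStripEstimates.conj (h : HasStripEstimates Ω y N v) :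
    HasStripEstimates Ω y N fun x => conj (v x) := by
  have hc : ∀ z : ℂ, ‖(starRingEnd ℂ) z‖ₑ = ‖z‖ₑ := fun z => by
    rw [← ofReal_norm, ← ofReal_norm, RCLike.norm_conj]
  have h2 : ∀ x, 2 * conj (v x) - conj (v (x + y)) - conj (v (x - y)) =
      conj (2 * v x - v (x + y) - v (x - y)) := fun x => by
    rw [map_sub, map_sub, map_mul, Complex.conj_ofNat]
  refine ⟨?_, ?_, ?_, ?_, ?_, ?_, ?_⟩
  · exact Complex.continuous_conj.measurable.comp h.measurable
  · simpa only [hc] using h.sq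
  · simpa only [hc] using h.strip
  · simpa only [hc] using h.strip_neg
  · simpa only [← map_sub, hc] using h.diff
  · simpa only [← map_sub, hc] using h.diff_neg
  · simpa only [h2, hc] using h.second_diff

lemma mem_stripSet_neg {x : ℂ} : x + y ∈ stripSet Ω (-y) ↔ x ∈ stripSet Ω y := by
  simp only [stripSet, mem_ofPred_eq, add_neg_cancel_right]
  tauto

/-- For `x` in `Ω` this is the discrete Leibniz rule for `vw`, corrected at the shifted points that
fall outside `Ω`. For `x` outside, only shifted points inside `Ω` contribute. Either way the
boundary terms are evaluated at the shifted point, hence the opposite signs of the strips. -/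
lemma enorm_secondDiff_indicator_le (x : ℂ) :
    ‖2 * Ω.indicator (fun x => v x * w x) x - Ω.indicator (fun x => v x * w x) (x + y) -
      Ω.indicator (fun x => v x * w x) (x - y)‖ₑ ≤
    (stripSet Ω (-y)).indicator (fun x => ‖v x‖ₑ * ‖w x‖ₑ) (x + y) +
    (stripSet Ω y).indicator (fun x => ‖v x‖ₑ * ‖w x‖ₑ) (x - y) +
    Ω.indicator (fun x => ‖v x‖ₑ * ‖2 * w x - w (x + y) - w (x - y)‖ₑ +
      ‖2 * v x - v (x + y) - v (x - y)‖ₑ * ‖w x‖ₑ +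
      ‖v x - v (x + y)‖ₑ * ‖w x - w (x + y)‖ₑ +
      ‖v x - v (x - y)‖ₑ * ‖w x - w (x - y)‖ₑ) x := by
  have hm1 : x + y ∈ stripSet Ω (-y) ↔ ¬(x ∈ Ω ↔ x + y ∈ Ω) := mem_stripSet_neg
  have hm2 : x - y ∈ stripSet Ω y ↔ ¬(x ∈ Ω ↔ x - y ∈ Ω) := by
    simp only [stripSet, mem_ofPred_eq, sub_add_cancel]; tauto
  set F := Ω.indicator (fun x => v x * w x) with hF
  by_cases hx : x ∈ Ω
  · have h1 : ‖v (x + y) * w (x + y) - F (x + y)‖ₑ ≤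
        (stripSet Ω (-y)).indicator (fun x => ‖v x‖ₑ * ‖w x‖ₑ) (x + y) := by
      by_cases h : x + y ∈ Ω
      · rw [hF, indicator_of_mem h]; simp
      · rw [hF, indicator_of_notMem h, indicator_of_mem (hm1.2 (by tauto))]; simp [enorm_mul]
    have h2 : ‖v (x - y) * w (x - y) - F (x - y)‖ₑ ≤
        (stripSet Ω y).indicator (fun x => ‖v x‖ₑ * ‖w x‖ₑ) (x - y) := by
      by_cases h : x - y ∈ Ω
      · rw [hF, indicator_of_mem h]; simp
      · rw [hF, indicator_of_notMem h, indicator_of_mem (hm2.2 (by tauto))]; simp [enorm_mul]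
    rw [indicator_of_mem hx]
    have e1 : 2 * F x - F (x + y) - F (x - y) =
        (v (x + y) * w (x + y) - F (x + y)) + (v (x - y) * w (x - y) - F (x - y)) +
        (v x * (2 * w x - w (x + y) - w (x - y)) +
          (2 * v x - v (x + y) - v (x - y)) * w x -
          (v x - v (x + y)) * (w x - w (x + y)) -
          (v x - v (x - y)) * (w x - w (x - y))) := by
      rw [hF, indicator_of_mem hx]; ring
    rw [e1]
    refine (enorm_add_le _ _).trans (add_le_add ((enorm_add_le _ _).trans (add_le_add h1 h2)) ?_)
    refine (enorm_sub_le).trans (add_le_add (enorm_sub_le.trans (add_le_add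
      ((enorm_add_le _ _).trans ?_) ?_)) ?_) <;> simp [enorm_mul]
  · have h1 : ‖F (x + y)‖ₑ ≤
        (stripSet Ω (-y)).indicator (fun x => ‖v x‖ₑ * ‖w x‖ₑ) (x + y) := by
      by_cases h : x + y ∈ Ω
      · rw [hF, indicator_of_mem h, indicator_of_mem (hm1.2 (by tauto))]; simp [enorm_mul]
      · rw [hF, indicator_of_notMem h]; simp
    have h2 : ‖F (x - y)‖ₑ ≤
        (stripSet Ω y).indicator (fun x => ‖v x‖ₑ * ‖w x‖ₑ) (x - y) := by
      by_cases h : x - y ∈ Ω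
      · rw [hF, indicator_of_mem h, indicator_of_mem (hm2.2 (by tauto))]; simp [enorm_mul]
      · rw [hF, indicator_of_notMem h]; simp
    have e0 : F x = 0 := indicator_of_notMem hx _
    rw [indicator_of_notMem hx, add_zero, e0, mul_zero, zero_sub]
    refine enorm_sub_le.trans (add_le_add ?_ h2)
    rwa [enorm_neg]

/-- An oscillating factor with `e (x + y) = - e x` gains one power of `y`. -/
lemma enorm_integral_oscillating_le (hΩ : MeasurableSet Ω) (he : Measurable e)
    (he1 : ∀ x, ‖e x‖ = 1) (hey : ∀ x, e (x + y) = - e x) (hN : N ≠ ⊤) (hM : M ≠ ⊤)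
    (hv : HasStripEstimates Ω y N v) (hw : HasStripEstimates Ω y M w) :
    ‖∫ x in Ω, e x * (v x * w x)‖ₑ ≤ 2 * (‖y‖ₑ * (N * M)) := by
  set F := Ω.indicator (fun x => v x * w x) with hF
  have hvm := hv.measurable
  have hwm := hw.measurable
  have hFm : Measurable F := (hvm.mul hwm).indicator hΩ
  have he1' : ∀ x, ‖e x‖ₑ = 1 := fun x => by rw [← ofReal_norm, he1]; simp
  have hFi : ∫⁻ x, ‖F x‖ₑ < ⊤ := by
    simp only [hF, enorm_indicator_eq_indicator_enorm, enorm_mul]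
    rw [lintegral_indicator hΩ]
    exact (lintegral_mul_le_of_sq_le (by fun_prop) (by fun_prop) hv.sq hw.sq).trans_lt
      (ENNReal.mul_lt_top hN.lt_top hM.lt_top)
  have hG : ∀ s : ℂ, Integrable fun x => e x * F (x + s) := fun s => by
    refine ⟨(by fun_prop : Measurable _).aestronglyMeasurable, ?_⟩
    simp only [HasFiniteIntegral, enorm_mul, he1', one_mul]
    rwa [lintegral_add_right_eq_self (fun x => ‖F x‖ₑ) s]
  have hG0 : Integrable fun x => e x * F x := by simpa using hG 0
  have hG' : Integrable fun x => e x * F (x - y) := by simpa [sub_eq_add_neg] using hG (-y)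
  have hey' : ∀ x, e (x - y) = - e x := fun x => by
    have := hey (x - y)
    rw [sub_add_cancel] at this
    rw [this, neg_neg]
  have hI : ∫ x in Ω, e x * (v x * w x) = ∫ x, e x * F x := by
    rw [← integral_indicator hΩ]
    congr 1 with x
    rw [hF]
    by_cases hx : x ∈ Ω <;> simp [hx]
  have h1 : ∫ x, e x * F (x + y) = - ∫ x, e x * F x := by
    rw [← integral_add_right_eq_self (fun x => e x * F x) y, ← integral_neg]
    congr 1 with x
    rw [hey]; ring
  have h2 : ∫ x, e x * F (x - y) = - ∫ x, e x * F x := by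
    rw [← integral_sub_right_eq_self (fun x => e x * F x) y, ← integral_neg]
    congr 1 with x
    rw [hey']; ring
  -- Each translate reproduces the integral with opposite sign, so the second difference counts it
  -- `2 + 1 + 1` times.
  have h4 : 4 * ∫ x in Ω, e x * (v x * w x) =
      ∫ x, e x * (2 * F x - F (x + y) - F (x - y)) := by
    have e1 : ∀ x, e x * (2 * F x - F (x + y) - F (x - y)) =
        2 * (e x * F x) - e x * F (x + y) - e x * F (x - y) := fun x => by ring
    simp_rw [e1]
    have hG2 : Integrable fun x => 2 * (e x * F x) - e x * F (x + y) :=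
      (hG0.const_mul 2).sub (hG y)
    rw [integral_sub hG2 hG', integral_sub (hG0.const_mul 2) (hG y),
      integral_const_mul, h1, h2, hI]
    ring
  -- Six terms, two from the strips and four from the Leibniz rule, each at most `|y| N M` by
  -- Cauchy-Schwarz.
  have h5 : ‖4 * ∫ x in Ω, e x * (v x * w x)‖ₑ ≤ 6 * (‖y‖ₑ * (N * M)) := by
    rw [h4]
    refine (enorm_integral_le_lintegral_enorm _).trans ?_
    simp only [enorm_mul, he1', one_mul]
    refine (lintegral_mono fun x => enorm_secondDiff_indicator_le x).trans ?_
    have hs1 := measurableSet_stripSet hΩ y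
    have hs2 := measurableSet_stripSet hΩ (-y)
    have hm : Measurable fun x => ‖v x‖ₑ * ‖w x‖ₑ := by fun_prop
    have hm1 : Measurable fun x =>
        (stripSet Ω (-y)).indicator (fun x => ‖v x‖ₑ * ‖w x‖ₑ) (x + y) :=
      (hm.indicator hs2).comp (measurable_add_const y)
    have hm2 : Measurable fun x =>
        (stripSet Ω y).indicator (fun x => ‖v x‖ₑ * ‖w x‖ₑ) (x - y) :=
      (hm.indicator hs1).comp (measurable_sub_const y)
    have hm3 : Measurable fun x =>
        (stripSet Ω (-y)).indicator (fun x => ‖v x‖ₑ * ‖w x‖ₑ) (x + y) +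
        (stripSet Ω y).indicator (fun x => ‖v x‖ₑ * ‖w x‖ₑ) (x - y) := hm1.add hm2
    rw [lintegral_add_left hm3, lintegral_add_left hm1, lintegral_add_right_eq_self
      ((stripSet Ω (-y)).indicator (fun x => ‖v x‖ₑ * ‖w x‖ₑ)) y,
      lintegral_sub_right_eq_self
      ((stripSet Ω y).indicator (fun x => ‖v x‖ₑ * ‖w x‖ₑ)) y,
      lintegral_indicator hs1, lintegral_indicator hs2, lintegral_indicator hΩ,
      lintegral_add_left (by fun_prop), lintegral_add_left (by fun_prop),
      lintegral_add_left (by fun_prop)]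
    have hr : ‖y‖ₑ ^ (1 / 2 : ℝ) * ‖y‖ₑ ^ (1 / 2 : ℝ) = ‖y‖ₑ := by
      rw [← pow_two, ← ENNReal.rpow_two, ← ENNReal.rpow_mul]; norm_num
    have b1 := lintegral_mul_le_of_sq_le (by fun_prop) (by fun_prop) hv.strip_neg hw.strip_neg
    have b2 := lintegral_mul_le_of_sq_le (by fun_prop) (by fun_prop) hv.strip hw.strip
    have b3 := lintegral_mul_le_of_sq_le (by fun_prop) (by fun_prop) hv.sq hw.second_diff
    have b4 := lintegral_mul_le_of_sq_le (by fun_prop) (by fun_prop) hv.second_diff hw.sq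
    have b5 := lintegral_mul_le_of_sq_le (by fun_prop) (by fun_prop) hv.diff hw.diff
    have b6 := lintegral_mul_le_of_sq_le (by fun_prop) (by fun_prop) hv.diff_neg hw.diff_neg
    have er : ‖y‖ₑ ^ (1 / 2 : ℝ) * N * (‖y‖ₑ ^ (1 / 2 : ℝ) * M) = ‖y‖ₑ * (N * M) := by
      calc _ = (‖y‖ₑ ^ (1 / 2 : ℝ) * ‖y‖ₑ ^ (1 / 2 : ℝ)) * (N * M) := by ring
        _ = _ := by rw [hr]
    rw [er] at b1 b2 b5 b6
    rw [show N * (‖y‖ₑ * M) = ‖y‖ₑ * (N * M) by ring] at b3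
    rw [show ‖y‖ₑ * N * M = ‖y‖ₑ * (N * M) by ring] at b4
    refine (add_le_add (add_le_add b1 b2) (add_le_add (add_le_add (add_le_add b3 b4) b5)
      b6)).trans (le_of_eq ?_)
    ring
  have h6 : ‖(4 : ℂ)‖ₑ = 4 := by rw [← ofReal_norm]; simp
  rw [enorm_mul, h6] at h5
  have h7 : 4 * ‖∫ x in Ω, e x * (v x * w x)‖ₑ ≤ 4 * (2 * (‖y‖ₑ * (N * M))) := by
    calc _ ≤ 6 * (‖y‖ₑ * (N * M)) := h5
      _ ≤ 8 * (‖y‖ₑ * (N * M)) := mul_le_mul' (by norm_num) le_rfl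
      _ = _ := by ring
  exact (ENNReal.mul_le_mul_iff_right (by simp) (by simp)).1 h7

end Pairing

/-! ### Difference estimates for Cauchy transforms -/

section CauchyTransform

/-- The Cauchy transform `∫ U(z) / (x - z) m(dz)`. -/
def cauchyTransform (m : Measure ℂ) (U : ℂ → ℂ) (x : ℂ) : ℂ := ∫ z, U z / (x - z) ∂m

variable {m : Measure ℂ} {U : ℂ → ℂ} {ε : ℝ}

lemma enorm_div_sub (x z : ℂ) : ‖U z / (x - z)‖ₑ = cauchyAbs x z * ‖U z‖ₑ := by
  rw [div_eq_mul_one_div, enorm_mul, enorm_one_div_sub, mul_comm]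

lemma measurable_cauchyTransform [SFinite m] (hU : Measurable U) :
    Measurable (cauchyTransform m U) := by
  have : StronglyMeasurable fun p : ℂ × ℂ => U p.2 / (p.1 - p.2) :=
    (by fun_prop : Measurable fun p : ℂ × ℂ => U p.2 / (p.1 - p.2)).stronglyMeasurable
  exact this.integral_prod_right'.measurable

lemma enorm_cauchyTransform_le (x : ℂ) :
    ‖cauchyTransform m U x‖ₑ ≤ ∫⁻ z, cauchyAbs x z * ‖U z‖ₑ ∂m := by
  refine (enorm_integral_le_lintegral_enorm _).trans (le_of_eq ?_)
  simp_rw [enorm_div_sub]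

lemma integrable_div_sub (hU : Measurable U) {x : ℂ}
    (hx : ∫⁻ z, cauchyAbs x z * ‖U z‖ₑ ∂m < ⊤) : Integrable (fun z => U z / (x - z)) m := by
  refine ⟨(by fun_prop : Measurable _).aestronglyMeasurable, ?_⟩
  simpa only [HasFiniteIntegral, enorm_div_sub] using hx

lemma ae_ne_of_absolutelyContinuous (hm : m ≪ volume) (x : ℂ) : ∀ᵐ z ∂m, x - z ≠ 0 := by
  have : ∀ᵐ z : ℂ, z ≠ x := compl_mem_ae_iff.2 (measure_singleton x)
  exact hm.ae_le (this.mono fun z hz => sub_ne_zero.2 hz.symm)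

lemma enorm_cauchyTransform_sub_le (hm : m ≪ volume) (hU : Measurable U) {x y : ℂ}
    (h₀ : ∫⁻ z, cauchyAbs x z * ‖U z‖ₑ ∂m < ⊤) (h₁ : ∫⁻ z, cauchyAbs (x + y) z * ‖U z‖ₑ ∂m < ⊤) :
    ‖cauchyTransform m U x - cauchyTransform m U (x + y)‖ₑ ≤
      ∫⁻ z, diffKernel y x z * ‖U z‖ₑ ∂m := by
  unfold cauchyTransform
  rw [← integral_sub (integrable_div_sub hU h₀) (integrable_div_sub hU h₁)]
  refine (enorm_integral_le_lintegral_enorm _).trans (le_of_eq (lintegral_congr_ae ?_))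
  filter_upwards [ae_ne_of_absolutelyContinuous hm x, ae_ne_of_absolutelyContinuous hm (x + y)]
    with z hz hz'
  have : U z / (x - z) - U z / (x + y - z) = y * ((1 / (x - z)) * (1 / (x + y - z))) * U z := by
    field_simp; ring
  rw [this, enorm_mul, enorm_mul, enorm_mul, enorm_one_div_sub, enorm_one_div_sub, diffKernel,
    ofReal_norm]

lemma enorm_cauchyTransform_secondDiff_le (hm : m ≪ volume) (hU : Measurable U) {x y : ℂ}
    (h₀ : ∫⁻ z, cauchyAbs x z * ‖U z‖ₑ ∂m < ⊤) (h₁ : ∫⁻ z, cauchyAbs (x + y) z * ‖U z‖ₑ ∂m < ⊤)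
    (h₂ : ∫⁻ z, cauchyAbs (x - y) z * ‖U z‖ₑ ∂m < ⊤) :
    ‖2 * cauchyTransform m U x - cauchyTransform m U (x + y) - cauchyTransform m U (x - y)‖ₑ ≤
      ∫⁻ z, secondDiffKernel y x z * ‖U z‖ₑ ∂m := by
  unfold cauchyTransform
  have i0 := (integrable_div_sub hU h₀).const_mul 2
  have i1 := integrable_div_sub hU h₁
  have i2 := integrable_div_sub hU h₂
  have i3 : Integrable (fun z => 2 * (U z / (x - z)) - U z / (x + y - z)) m := i0.sub i1
  rw [← integral_const_mul, ← integral_sub i0 i1, ← integral_sub i3 i2]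
  refine (enorm_integral_le_lintegral_enorm _).trans (le_of_eq (lintegral_congr_ae ?_))
  filter_upwards [ae_ne_of_absolutelyContinuous hm x, ae_ne_of_absolutelyContinuous hm (x + y),
    ae_ne_of_absolutelyContinuous hm (x - y)] with z hz hz' hz''
  have : 2 * (U z / (x - z)) - U z / (x + y - z) - U z / (x - y - z) =
      -(2 * y ^ 2) * ((1 / (x - z)) * (1 / (x + y - z)) * (1 / (x - y - z))) * U z := by
    field_simp; ring
  rw [this, enorm_mul, enorm_mul, enorm_mul, enorm_mul, enorm_one_div_sub, enorm_one_div_sub,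
    enorm_one_div_sub, secondDiffKernel, enorm_neg, ← ofReal_norm (2 * y ^ 2)]
  simp

/-- On every ball the potential is square integrable, hence finite almost everywhere; countably many
balls exhaust the plane. -/
lemma ae_lintegral_cauchyAbs_lt_top (hε : 0 < ε) {K : ℝ≥0∞} (hK : K ≠ ⊤) [SFinite m]
    (hm : m ≤ K • weightMeasure ε) (hU : Measurable U) (hU2 : ∫⁻ z, ‖U z‖ₑ ^ 2 ∂m ≠ ⊤) :
    ∀ᵐ x : ℂ, ∫⁻ z, cauchyAbs x z * ‖U z‖ₑ ∂m < ⊤ := by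
  have hmeas : Measurable fun x => ∫⁻ z, cauchyAbs x z * ‖U z‖ₑ ∂m :=
    Measurable.lintegral_prod_right' (f := fun p : ℂ × ℂ => cauchyAbs p.1 p.2 * ‖U p.2‖ₑ)
      (by fun_prop)
  have h : ∀ n : ℕ, ∀ᵐ x : ℂ, x ∈ Metric.ball (0 : ℂ) n →
      ∫⁻ z, cauchyAbs x z * ‖U z‖ₑ ∂m < ⊤ := fun n => by
    obtain ⟨C, hC, h⟩ := exists_setLIntegral_sq_cauchyAbs_le hε n
    obtain ⟨C', hC', h'⟩ := exists_hasRieszBound_ball n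
    have h2 := h _ subset_rfl measurableSet_ball _ (h' _ subset_rfl) K m hm
      (fun z => ‖U z‖ₑ) (by fun_prop)
    rw [← ae_restrict_iff' measurableSet_ball]
    have h3 := ae_lt_top (hmeas.pow_const 2) (h2.trans_lt (ENNReal.mul_lt_top
      (ENNReal.mul_lt_top (ENNReal.mul_lt_top hC.lt_top hK.lt_top) hC'.lt_top) hU2.lt_top)).ne
    filter_upwards [h3] with x hx
    simpa using hx
  rw [← ae_all_iff] at h
  filter_upwards [h] with x hx
  obtain ⟨n, hn⟩ := exists_nat_gt ‖x‖
  exact hx n (mem_ball_zero_iff.2 hn)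

/-- Stated for a general measure below a multiple of the weight because it is applied to two:
Lebesgue measure on `Ω`, for the transform inside `B`, and the weighted measure, for the dual
function. -/
lemma exists_hasStripEstimates_cauchyTransform (hε : 0 < ε) (R : ℝ) {K : ℝ≥0∞} (hK : K ≠ ⊤) :
    ∃ c : ℝ≥0∞, c ≠ ⊤ ∧ ∀ Ω ⊆ Metric.ball (0 : ℂ) R, Convex ℝ Ω → MeasurableSet Ω →
      ∀ y : ℂ, y ≠ 0 → ‖y‖ ≤ 1 → ∀ (m : Measure ℂ) [SFinite m], m ≤ K • weightMeasure ε →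
      ∀ (U : ℂ → ℂ) (N : ℝ≥0∞), Measurable U → N ≠ ⊤ → ∫⁻ z, ‖U z‖ₑ ^ 2 ∂m ≤ N ^ 2 →
      HasStripEstimates Ω y (c * N) (cauchyTransform m U) := by
  obtain ⟨C₁, hC₁, h₁⟩ := exists_setLIntegral_sq_cauchyAbs_le hε (R + 1)
  obtain ⟨C₂, hC₂, h₂⟩ := exists_hasRieszBound_ball (R + 1)
  obtain ⟨C₃, hC₃, h₃⟩ := exists_hasRieszBound_stripSet R
  obtain ⟨C₄, hC₄, h₄⟩ := exists_setLIntegral_sq_diffKernel_le hε R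
  obtain ⟨C₅, hC₅, h₅⟩ := exists_setLIntegral_sq_secondDiffKernel_le hε.le
  set D := C₁ * K * C₂ + C₁ * K * C₃ + C₄ * K + C₅ * K with hD
  have hDt : D ≠ ⊤ := by
    have := hK.lt_top
    have := hC₁.lt_top
    have := hC₂.lt_top
    have := hC₃.lt_top
    have := hC₄.lt_top
    have := hC₅.lt_top
    refine ne_of_lt ?_
    rw [hD]
    simp only [ENNReal.add_lt_top]
    exact ⟨⟨⟨by apply_rules [ENNReal.mul_lt_top], by apply_rules [ENNReal.mul_lt_top]⟩,
      by apply_rules [ENNReal.mul_lt_top]⟩, by apply_rules [ENNReal.mul_lt_top]⟩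
  -- Using `1 + D` as the constant avoids taking a square root of `D`.
  have hDsq : D ≤ (1 + D) ^ 2 := by
    calc D ≤ 1 + D := le_add_self
      _ = (1 + D) ^ 1 := (pow_one _).symm
      _ ≤ (1 + D) ^ 2 := pow_le_pow_right₀ le_self_add (by norm_num)
  refine ⟨1 + D, by simp [hDt], fun Ω hΩ hconv hΩm y hy hy1 m _ hm U N hU hN hUN => ?_⟩
  have hΩ1 : Ω ⊆ Metric.ball (0 : ℂ) (R + 1) :=
    hΩ.trans (Metric.ball_subset_ball (by linarith))
  have hstrip : ∀ s : ℂ, ‖s‖ ≤ 1 → stripSet Ω s ⊆ Metric.ball (0 : ℂ) (R + 1) := by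
    intro s hs x hx
    by_cases h : x ∈ Ω
    · exact hΩ1 h
    · have h2 : x + s ∈ Ω := by by_contra h2; exact hx (by simp [h, h2])
      have := mem_ball_zero_iff.1 (hΩ h2)
      rw [mem_ball_zero_iff]
      calc ‖x‖ = ‖x + s - s‖ := by simp
        _ ≤ ‖x + s‖ + ‖s‖ := norm_sub_le _ _
        _ < R + 1 := by linarith
  have hmvol : m ≪ volume := (Measure.absolutelyContinuous_of_le_smul hm).trans
    weightMeasure_absolutelyContinuous_volume
  have hfin := ae_lintegral_cauchyAbs_lt_top hε hK hm hU
    (hUN.trans_lt (ENNReal.pow_lt_top hN.lt_top)).ne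
  have hfin1 : ∀ s : ℂ, ∀ᵐ x : ℂ, ∫⁻ z, cauchyAbs (x + s) z * ‖U z‖ₑ ∂m < ⊤ := fun s =>
    (measurePreserving_add_right volume s).quasiMeasurePreserving.ae hfin
  have hg : Measurable fun z => ‖U z‖ₑ := by fun_prop
  have hr : (‖y‖ₑ ^ (1 / 2 : ℝ)) ^ 2 = ‖y‖ₑ := by
    rw [← ENNReal.rpow_two, ← ENNReal.rpow_mul]; norm_num
  have hle : ∀ {d : ℝ≥0∞}, d ≤ D → d * ∫⁻ z, ‖U z‖ₑ ^ 2 ∂m ≤ ((1 + D) * N) ^ 2 := by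
    intro d hd
    rw [mul_pow]
    exact mul_le_mul' (hd.trans hDsq) hUN
  have d1 : C₁ * K * C₂ ≤ D := by rw [hD, add_assoc, add_assoc]; exact le_self_add
  have d2 : C₁ * K * C₃ ≤ D := by rw [hD, add_assoc]; exact le_add_self.trans le_self_add
  have d3 : C₄ * K ≤ D := le_add_self.trans le_self_add
  have d4 : C₅ * K ≤ D := le_add_self
  have hstrips : ∀ s : ℂ, ‖s‖ₑ = ‖y‖ₑ → ‖s‖ ≤ 1 →
      ∫⁻ x in stripSet Ω s, ‖cauchyTransform m U x‖ₑ ^ 2 ≤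
        (‖y‖ₑ ^ (1 / 2 : ℝ) * ((1 + D) * N)) ^ 2 := by
    intro s hs hs1
    calc ∫⁻ x in stripSet Ω s, ‖cauchyTransform m U x‖ₑ ^ 2 ≤ _ :=
          lintegral_mono fun x => pow_le_pow_left₀ zero_le (enorm_cauchyTransform_le x) 2
      _ ≤ _ := h₁ _ (hstrip s hs1) (measurableSet_stripSet hΩm s) _ (h₃ Ω hΩ hconv hΩm s) K m hm _
          hg
      _ = ‖y‖ₑ * (C₁ * K * C₃ * ∫⁻ z, ‖U z‖ₑ ^ 2 ∂m) := by rw [ofReal_norm, hs]; ring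
      _ ≤ ‖y‖ₑ * ((1 + D) * N) ^ 2 := by gcongr; exact hle d2
      _ = _ := by rw [mul_pow (‖y‖ₑ ^ (1 / 2 : ℝ)), hr]
  have hdiffs : ∀ s : ℂ, s ≠ 0 → ‖s‖ₑ = ‖y‖ₑ → ‖s‖ ≤ 1 →
      ∫⁻ x in Ω, ‖cauchyTransform m U x - cauchyTransform m U (x + s)‖ₑ ^ 2 ≤
        (‖y‖ₑ ^ (1 / 2 : ℝ) * ((1 + D) * N)) ^ 2 := by
    intro s hs0 hs hs1
    calc ∫⁻ x in Ω, ‖cauchyTransform m U x - cauchyTransform m U (x + s)‖ₑ ^ 2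
        ≤ ∫⁻ x in Ω, (∫⁻ z, diffKernel s x z * ‖U z‖ₑ ∂m) ^ 2 := by
          refine lintegral_mono_ae (ae_restrict_of_ae ?_)
          filter_upwards [hfin, hfin1 s] with x hx hx'
          exact pow_le_pow_left₀ zero_le (enorm_cauchyTransform_sub_le hmvol hU hx hx') 2
      _ ≤ _ := h₄ Ω hΩ hΩm s hs0 hs1 K m hm _ hg
      _ = ‖y‖ₑ * (C₄ * K * ∫⁻ z, ‖U z‖ₑ ^ 2 ∂m) := by rw [ofReal_norm, hs]; ring
      _ ≤ ‖y‖ₑ * ((1 + D) * N) ^ 2 := by gcongr; exact hle d3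
      _ = _ := by rw [mul_pow (‖y‖ₑ ^ (1 / 2 : ℝ)), hr]
  refine ⟨measurable_cauchyTransform hU, ?_, hstrips y rfl hy1, hstrips (-y) (enorm_neg y)
    (by rwa [norm_neg]), hdiffs y hy rfl hy1, ?_, ?_⟩
  · calc ∫⁻ x in Ω, ‖cauchyTransform m U x‖ₑ ^ 2 ≤ _ :=
          lintegral_mono fun x => pow_le_pow_left₀ zero_le (enorm_cauchyTransform_le x) 2
      _ ≤ _ := h₁ _ hΩ1 hΩm _ (h₂ Ω hΩ1) K m hm _ hg
      _ ≤ _ := hle d1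
  · simpa only [sub_eq_add_neg] using hdiffs (-y) (neg_ne_zero.2 hy) (enorm_neg y)
      (by rwa [norm_neg])
  · calc ∫⁻ x in Ω, ‖2 * cauchyTransform m U x - cauchyTransform m U (x + y) -
            cauchyTransform m U (x - y)‖ₑ ^ 2
        ≤ ∫⁻ x in Ω, (∫⁻ z, secondDiffKernel y x z * ‖U z‖ₑ ∂m) ^ 2 := by
          refine lintegral_mono_ae (ae_restrict_of_ae ?_)
          filter_upwards [hfin, hfin1 y, hfin1 (-y)] with x hx hx' hx''
          rw [← sub_eq_add_neg] at hx''
          exact pow_le_pow_left₀ zero_le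
            (enorm_cauchyTransform_secondDiff_le hmvol hU hx hx' hx'') 2
      _ ≤ _ := h₅ Ω y hy K m hm _ hg
      _ = ‖y‖ₑ ^ 2 * (C₅ * K * ∫⁻ z, ‖U z‖ₑ ^ 2 ∂m) := by
          rw [ENNReal.ofReal_pow (norm_nonneg y), ofReal_norm]; ring
      _ ≤ ‖y‖ₑ ^ 2 * ((1 + D) * N) ^ 2 := by gcongr; exact hle d4
      _ = _ := by rw [mul_pow ‖y‖ₑ]

end CauchyTransform

/-! ### Block operators and the Neumann series -/

section Resolvent

variable {X : Type*} [NormedAddCommGroup X] [NormedSpace ℂ X]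

@[simp]
lemma blockOp_apply (a b c d : X →L[ℂ] X) (x : X × X) :
    blockOp a b c d x = (a x.1 + b x.2, c x.1 + d x.2) := rfl

lemma blockOp_mul (a b c d a' b' c' d' : X →L[ℂ] X) :
    blockOp a b c d * blockOp a' b' c' d' =
      blockOp (a * a' + b * c') (a * b' + b * d') (c * a' + d * c') (c * b' + d * d') := by
  ext x <;> simp

lemma blockOp_one : blockOp (1 : X →L[ℂ] X) 0 0 1 = 1 := by
  ext x <;> simp

lemma one_sub_opK_mul (A B : X →L[ℂ] X) :
    1 - opK A B * opK A B = blockOp (1 - A * B) 0 0 (1 - B * A) := by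
  ext x <;> simp [opK]

lemma one_add_opK (A B : X →L[ℂ] X) : 1 + opK A B = blockOp 1 A B 1 := by
  ext x <;> simp [opK]

lemma norm_opK_le {A B : X →L[ℂ] X} {C : ℝ} (hA : ‖A‖ ≤ C) (hB : ‖B‖ ≤ C) : ‖opK A B‖ ≤ C := by
  have hC : 0 ≤ C := (norm_nonneg A).trans hA
  refine ContinuousLinearMap.opNorm_le_bound _ hC fun x => ?_
  simp only [opK, blockOp_apply, zero_apply, zero_add, add_zero]
  refine max_le ?_ ?_
  · exact (A.le_of_opNorm_le hA _).trans (by gcongr; exact norm_snd_le x)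
  · exact (B.le_of_opNorm_le hB _).trans (by gcongr; exact norm_fst_le x)

lemma norm_opK_mul_opK_le {A B : X →L[ℂ] X} {C : ℝ} (hA : ‖A * B‖ ≤ C) (hB : ‖B * A‖ ≤ C) :
    ‖opK A B * opK A B‖ ≤ C := by
  have hC : 0 ≤ C := (norm_nonneg _).trans hA
  refine ContinuousLinearMap.opNorm_le_bound _ hC fun x => ?_
  simp only [opK, blockOp_apply, mul_apply_eq_comp, zero_apply,
    zero_add, add_zero]
  refine max_le ?_ ?_
  · exact ((A * B).le_of_opNorm_le hA _).trans (by gcongr; exact norm_fst_le x)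
  · exact ((B * A).le_of_opNorm_le hB _).trans (by gcongr; exact norm_snd_le x)

lemma isUnit_one_sub_of_norm_le_half {Y : Type*} [NormedAddCommGroup Y] [NormedSpace ℂ Y]
    [CompleteSpace Y] {T : Y →L[ℂ] Y} (hT : ‖T‖ ≤ 1 / 2) : IsUnit (1 - T) :=
  (Units.oneSub T (hT.trans_lt (by norm_num))).isUnit

lemma norm_inverse_one_sub_le {Y : Type*} [NormedAddCommGroup Y] [NormedSpace ℂ Y]
    [CompleteSpace Y] {T : Y →L[ℂ] Y} (hT : ‖T‖ ≤ 1 / 2) : ‖Ring.inverse (1 - T)‖ ≤ 2 := by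
  have h := Ring.mul_inverse_cancel _ (isUnit_one_sub_of_norm_le_half hT)
  set S := Ring.inverse (1 - T)
  have h1 : S = 1 + T * S := by
    rw [sub_mul, one_mul, sub_eq_iff_eq_add] at h; exact h
  have h2 : ‖S‖ ≤ 1 + 1 / 2 * ‖S‖ := by
    calc ‖S‖ = ‖1 + T * S‖ := by rw [← h1]
      _ ≤ ‖(1 : Y →L[ℂ] Y)‖ + ‖T * S‖ := norm_add_le _ _
      _ ≤ 1 + 1 / 2 * ‖S‖ := by
        gcongr
        · exact ContinuousLinearMap.norm_id_le
        · exact (norm_mul_le _ _).trans (by gcongr)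
  linarith

/-- The Neumann series for `1 - 𝒦` when `𝒦²` is small. -/
lemma opK_resolvent [CompleteSpace X] {A B : X →L[ℂ] X} {C : ℝ} (hA : ‖A‖ ≤ C) (hB : ‖B‖ ≤ C)
    (hAB : ‖A * B‖ ≤ 1 / 2) (hBA : ‖B * A‖ ≤ 1 / 2) :
    IsUnit (1 - opK A B) ∧
    ‖Ring.inverse (1 - opK A B)‖ ≤ 2 * (1 + C) ∧
    IsUnit (1 - opK A B * opK A B) ∧
    IsUnit (1 - A * B) ∧ IsUnit (1 - B * A) ∧
    Ring.inverse (1 - opK A B) =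
      Ring.inverse (1 - opK A B * opK A B) * (1 + opK A B) ∧
    Ring.inverse (1 - opK A B) =
      blockOp (Ring.inverse (1 - A * B)) 0 0 (Ring.inverse (1 - B * A)) * blockOp 1 A B 1 := by
  have hK2 := norm_opK_mul_opK_le hAB hBA
  have uK2 := isUnit_one_sub_of_norm_le_half hK2
  have uAB := isUnit_one_sub_of_norm_le_half hAB
  have uBA := isUnit_one_sub_of_norm_le_half hBA
  have nK2 := norm_inverse_one_sub_le hK2
  have nK := norm_opK_le hA hB
  have hdiag : Ring.inverse (1 - opK A B * opK A B) =
      blockOp (Ring.inverse (1 - A * B)) 0 0 (Ring.inverse (1 - B * A)) := by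
    refine uK2.mul_left_cancel ?_
    rw [Ring.mul_inverse_cancel _ uK2, one_sub_opK_mul, blockOp_mul,
      Ring.mul_inverse_cancel _ uAB, Ring.mul_inverse_cancel _ uBA]
    simp [blockOp_one]
  have hf1 : (1 - opK A B) * (1 + opK A B) = 1 - opK A B * opK A B := by
    rw [mul_add, mul_one, sub_mul, one_mul]; abel
  have hf2 : (1 + opK A B) * (1 - opK A B) = 1 - opK A B * opK A B := by
    rw [mul_sub, mul_one, add_mul, one_mul]; abel
  have hcomm : Commute (1 - opK A B) (1 + opK A B) := by rw [Commute, SemiconjBy, hf1, hf2]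
  -- A factor of a unit is a unit once the factors commute; `𝒦` itself need not be small.
  have uK : IsUnit (1 - opK A B) := by
    have : IsUnit ((1 - opK A B) * (1 + opK A B)) := by rwa [hf1]
    exact (hcomm.isUnit_mul_iff.1 this).1
  have hinv : Ring.inverse (1 - opK A B) =
      Ring.inverse (1 - opK A B * opK A B) * (1 + opK A B) := by
    refine uK.mul_right_cancel ?_
    rw [Ring.inverse_mul_cancel _ uK, mul_assoc, hf2, Ring.inverse_mul_cancel _ uK2]
  refine ⟨uK, ?_, uK2, uAB, uBA, hinv, ?_⟩
  · rw [hinv]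
    refine (norm_mul_le _ _).trans ?_
    gcongr
    exact (norm_add_le _ _).trans (add_le_add ContinuousLinearMap.norm_id_le nK)
  · rw [hinv, hdiag, one_add_opK]

end Resolvent

/-! ### The oscillating character -/

section Oscillation

/-- `e^{kz - conj(kz)}`. -/
def osc (k z : ℂ) : ℂ := Complex.exp (k * z - conj (k * z))

@[fun_prop]
lemma measurable_osc (k : ℂ) : Measurable (osc k) := by
  unfold osc
  have : Continuous fun z : ℂ => Complex.exp (k * z - conj (k * z)) := by fun_prop
  exact this.measurable

lemma norm_osc (k z : ℂ) : ‖osc k z‖ = 1 := by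
  simp [osc, Complex.norm_exp]

lemma enorm_osc (k z : ℂ) : ‖osc k z‖ₑ = 1 := by
  rw [← ofReal_norm, norm_osc]; simp

lemma conj_osc (k z : ℂ) : conj (osc k z) = osc (-k) z := by
  unfold osc
  rw [← Complex.exp_conj]
  congr 1
  simp
  ring

/-- The shift adds `πi/2` to `kz`; as this is purely imaginary, subtracting the conjugate doubles it
to `πi`. -/
lemma osc_add_half_period {k : ℂ} (hk : k ≠ 0) (z : ℂ) :
    osc k (z + Real.pi * Complex.I / (2 * k)) = - osc k z := by
  unfold osc
  have h1 : k * (z + Real.pi * Complex.I / (2 * k)) = k * z + Real.pi * Complex.I / 2 := by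
    field_simp
  have h2 : conj (Real.pi * Complex.I / 2 : ℂ) = -(Real.pi * Complex.I / 2) := by
    simp [map_ofNat]; ring
  rw [h1, map_add, h2, show k * z + Real.pi * Complex.I / 2 -
    (conj (k * z) + -(Real.pi * Complex.I / 2)) = k * z - conj (k * z) + Real.pi * Complex.I by ring,
    Complex.exp_add, Complex.exp_pi_mul_I]
  ring

end Oscillation

/-! ### Integral formulas and conjugation symmetry -/

section Formulas

variable {Ω : Set ℂ} {k : ℂ} {u : ℂ → ℂ}

lemma sourceA_eq (w : ℂ) : sourceA (Ω.indicator 1) k u w =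
    ((1 / ‖k‖ : ℝ) : ℂ) / 2 * Ω.indicator (fun w => osc (-k) w * u w) w := by
  unfold sourceA tau osc
  by_cases hw : w ∈ Ω
  · simp [hw]; ring
  · simp [hw]

lemma sourceA_div_eq (z w : ℂ) : sourceA (Ω.indicator 1) k u w / (z - w) =
    ((1 / ‖k‖ : ℝ) : ℂ) / 2 * Ω.indicator (fun w => osc (-k) w * u w / (z - w)) w := by
  rw [sourceA_eq]
  by_cases hw : w ∈ Ω
  · simp [hw]; ring
  · simp [hw]

lemma opE_sourceA (hΩ : MeasurableSet Ω) (hk : k ≠ 0) (z : ℂ) :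
    opE (1 / ‖k‖) (sourceA (Ω.indicator 1) k u) z =
      (1 / (2 * Real.pi)) *
        cauchyTransform (volume.restrict Ω) (fun w => osc (-k) w * u w) z := by
  unfold opE cauchyTransform
  simp_rw [sourceA_div_eq]
  rw [integral_const_mul, integral_indicator hΩ, ← mul_assoc]
  congr 1
  have : (‖k‖ : ℂ) ≠ 0 := by simpa using hk
  have hpi : (Real.pi : ℂ) ≠ 0 := by simp
  push_cast
  field_simp

lemma sourceB_eq (w : ℂ) : sourceB (Ω.indicator 1) k u w =
    conj (sourceA (Ω.indicator 1) k (fun w => conj (u w)) w) := by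
  change osc k w * _ = conj (osc (-k) w * _)
  rw [map_mul, conj_osc, neg_neg]
  congr 1
  simp [map_ofNat]

lemma opF_sourceB (h : ℝ) (z : ℂ) : opF h (sourceB (Ω.indicator 1) k u) z =
    conj (opE h (sourceA (Ω.indicator 1) k (fun w => conj (u w))) z) := by
  unfold opE opF
  rw [map_mul, ← integral_conj]
  congr 1
  · simp
  · congr 1 with w
    rw [sourceB_eq, map_div₀]

end Formulas

/-! ### Conjugation on the weighted space -/

section Norms

variable {ε : ℝ}

lemma eLpNorm_two_sq {μ : Measure ℂ} (f : ℂ → ℂ) :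
    eLpNorm f 2 μ ^ 2 = ∫⁻ z, ‖f z‖ₑ ^ 2 ∂μ := by
  rw [eLpNorm_eq_lintegral_rpow_enorm_toReal (by simp) (by simp), ← ENNReal.rpow_two,
    ← ENNReal.rpow_mul]
  simp

lemma WeightedL2.enorm_sq (u : WeightedL2 ε) :
    ‖u‖ₑ ^ 2 = ∫⁻ z, ‖u z‖ₑ ^ 2 ∂(weightMeasure ε) := by
  rw [Lp.enorm_def, eLpNorm_two_sq]

lemma WeightedL2.measurable (u : WeightedL2 ε) : Measurable u :=
  (Lp.stronglyMeasurable u).measurable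

lemma norm_le_of_enorm_le {E F : Type*} [NormedAddCommGroup E] [NormedAddCommGroup F] {x : E}
    {y : F} {c : ℝ≥0∞} (hc : c ≠ ⊤) (h : ‖x‖ₑ ≤ c * ‖y‖ₑ) : ‖x‖ ≤ c.toReal * ‖y‖ := by
  have := ENNReal.toReal_mono (ENNReal.mul_ne_top hc enorm_ne_top) h
  simpa using this

/-- Complex conjugation on the weighted space. -/
def conjL2 : WeightedL2 ε →L[ℝ] WeightedL2 ε :=
  ContinuousLinearMap.compLpL 2 (weightMeasure ε) (Complex.conjCLE : ℂ →L[ℝ] ℂ)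

lemma coeFn_conjL2 (u : WeightedL2 ε) :
    ∀ᵐ z ∂(weightMeasure ε), conjL2 u z = conj (u z) := by
  filter_upwards [ContinuousLinearMap.coeFn_compLpL (p := 2) (μ := weightMeasure ε)
    (Complex.conjCLE : ℂ →L[ℝ] ℂ) u] with z hz
  simpa [conjL2] using hz

lemma norm_conjL2 (u : WeightedL2 ε) : ‖conjL2 u‖ = ‖u‖ := by
  rw [Lp.norm_def, Lp.norm_def]
  congr 1
  refine eLpNorm_congr_norm_ae ?_
  filter_upwards [coeFn_conjL2 u] with z hz
  rw [hz, RCLike.norm_conj]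

lemma conjL2_conjL2 (u : WeightedL2 ε) : conjL2 (conjL2 u) = u := by
  refine Lp.ext ?_
  filter_upwards [coeFn_conjL2 u, coeFn_conjL2 (conjL2 u)] with z h1 h2
  rw [h2, h1, Complex.conj_conj]

lemma conjL2_smul (c : ℂ) (u : WeightedL2 ε) : conjL2 (c • u) = conj c • conjL2 u := by
  refine Lp.ext ?_
  filter_upwards [coeFn_conjL2 u, coeFn_conjL2 (c • u), Lp.coeFn_smul c u,
    Lp.coeFn_smul (conj c) (conjL2 u)] with z h1 h2 h3 h4
  rw [h2, h3, h4]
  simp [h1]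

/-- The operator `u ↦ σ conj (A (conj u))`. -/
def conjOp (σ : ℂ) (A : WeightedL2 ε →L[ℂ] WeightedL2 ε) : WeightedL2 ε →L[ℂ] WeightedL2 ε :=
  LinearMap.mkContinuous
    { toFun := fun u => σ • conjL2 (A (conjL2 u))
      map_add' := fun u v => by simp
      map_smul' := fun c u => by
        simp only [conjL2_smul, map_smul, Complex.conj_conj, RingHom.id_apply]
        exact smul_comm _ _ _ }
    (‖σ‖ * ‖A‖) fun u => by
      simp only [LinearMap.coe_mk, AddHom.coe_mk]
      rw [norm_smul, norm_conjL2, mul_assoc]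
      gcongr
      exact (A.le_opNorm _).trans_eq (by rw [norm_conjL2])

lemma conjOp_apply (σ : ℂ) (A : WeightedL2 ε →L[ℂ] WeightedL2 ε) (u : WeightedL2 ε) :
    conjOp σ A u = σ • conjL2 (A (conjL2 u)) := rfl

lemma norm_conjOp_le {σ : ℂ} (hσ : ‖σ‖ = 1) (A : WeightedL2 ε →L[ℂ] WeightedL2 ε) :
    ‖conjOp σ A‖ ≤ ‖A‖ := by
  refine (LinearMap.mkContinuous_norm_le _ (by positivity) _).trans (by rw [hσ, one_mul])

/-- With `J` denoting conjugation, `σJAJA u` and `AσJAJ (J u)` both have norm `‖σ‖ ‖A J A u‖`, and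
`J` is isometric. -/
lemma norm_conjOp_mul_le (σ : ℂ) (A : WeightedL2 ε →L[ℂ] WeightedL2 ε) :
    ‖conjOp σ A * A‖ ≤ ‖A * conjOp σ A‖ := by
  refine ContinuousLinearMap.opNorm_le_bound _ (norm_nonneg _) fun u => ?_
  have h : ‖(conjOp σ A * A) u‖ = ‖(A * conjOp σ A) (conjL2 u)‖ := by
    simp only [mul_apply_eq_comp, conjOp_apply, map_smul, norm_smul, conjL2_conjL2,
      norm_conjL2]
  rw [h, ← norm_conjL2 u]
  exact ContinuousLinearMap.le_opNorm _ _

end Norms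

/-! ### Construction of the operators and the duality formula -/

section Operators

variable {ε : ℝ} {Ω : Set ℂ} {k : ℂ} {K : ℝ≥0∞}

/-- The Cauchy transform over `Ω` of the modulated function, which is `A u`. -/
def modulatedTransform (Ω : Set ℂ) (k : ℂ) (u : ℂ → ℂ) (z : ℂ) : ℂ :=
  (1 / (2 * Real.pi)) * cauchyTransform (volume.restrict Ω) (fun w => osc (-k) w * u w) z

lemma enorm_one_div_two_pi_le : ‖(1 / (2 * Real.pi) : ℂ)‖ₑ ≤ 1 := by
  rw [← ofReal_norm, ENNReal.ofReal_le_one, norm_div, norm_mul, norm_one, Complex.norm_real,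
    Real.norm_of_nonneg Real.pi_pos.le, Complex.norm_ofNat]
  rw [div_le_one (by positivity)]
  linarith [Real.pi_gt_three]

lemma enorm_osc_mul (k : ℂ) (u : ℂ → ℂ) (w : ℂ) : ‖osc k w * u w‖ₑ = ‖u w‖ₑ := by
  rw [enorm_mul, enorm_osc, one_mul]

lemma measurable_modulatedTransform {u : ℂ → ℂ} (hu : Measurable u) :
    Measurable (modulatedTransform Ω k u) :=
  (measurable_cauchyTransform (by fun_prop)).const_mul _

lemma setLIntegral_sq_le (hK : (volume : Measure ℂ).restrict Ω ≤ K • weightMeasure ε)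
    (u : WeightedL2 ε) : ∫⁻ w in Ω, ‖u w‖ₑ ^ 2 ≤ K * ‖u‖ₑ ^ 2 := by
  rw [WeightedL2.enorm_sq]
  exact lintegral_mono_smul_measure hK _

lemma modulatedTransform_congr {u v : ℂ → ℂ} (h : u =ᵐ[weightMeasure ε] v) :
    modulatedTransform Ω k u = modulatedTransform Ω k v := by
  have h' : u =ᵐ[volume] v := volume_absolutelyContinuous_weightMeasure.ae_le h
  funext z
  unfold modulatedTransform cauchyTransform
  congr 1
  refine integral_congr_ae (ae_restrict_of_ae (h'.mono fun w hw => ?_))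
  simp only [hw]

lemma ae_integrable_modulated (hε : 0 < ε) (hKt : K ≠ ⊤)
    (hK : (volume : Measure ℂ).restrict Ω ≤ K • weightMeasure ε) (u : WeightedL2 ε) :
    ∀ᵐ z : ℂ, IntegrableOn (fun w => osc (-k) w * u w / (z - w)) Ω := by
  have hu := WeightedL2.measurable u
  have hm : Measurable fun w => osc (-k) w * u w := by fun_prop
  have h : ∫⁻ w in Ω, ‖osc (-k) w * u w‖ₑ ^ 2 ≠ ⊤ := by
    simp_rw [enorm_osc_mul]
    exact ((setLIntegral_sq_le hK u).trans_lt
      (ENNReal.mul_lt_top hKt.lt_top (ENNReal.pow_lt_top enorm_lt_top))).ne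
  filter_upwards [ae_lintegral_cauchyAbs_lt_top hε hKt hK hm h] with z hz
  exact integrable_div_sub hm hz

/-- The operators `A` exist and are bounded uniformly in `k`. -/
lemma exists_opA (hε : 0 < ε) (R : ℝ) {K : ℝ≥0∞} (hKt : K ≠ ⊤) :
    ∃ C : ℝ, 0 ≤ C ∧ ∀ Ω ⊆ Metric.ball (0 : ℂ) R, MeasurableSet Ω →
      (volume : Measure ℂ).restrict Ω ≤ K • weightMeasure ε → ∀ k : ℂ,
      ∃ A : WeightedL2 ε →L[ℂ] WeightedL2 ε, ‖A‖ ≤ C ∧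
        ∀ u, ∀ᵐ z ∂(weightMeasure ε), A u z = modulatedTransform Ω k u z := by
  obtain ⟨C, hC, h⟩ := exists_lintegral_weightMeasure_sq_cauchyAbs_le hε R
  set D := 1 + C * K with hD
  have hDt : D ≠ ⊤ := by simp [hD, ENNReal.mul_ne_top hC hKt]
  refine ⟨D.toReal, ENNReal.toReal_nonneg, fun Ω hΩ hΩm hK k => ?_⟩
  have hbd : ∀ u : WeightedL2 ε,
      ∫⁻ z, ‖modulatedTransform Ω k u z‖ₑ ^ 2 ∂(weightMeasure ε) ≤ (D * ‖u‖ₑ) ^ 2 := fun u => by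
    have hu := WeightedL2.measurable u
    have hsymm : ∀ x z, cauchyAbs z x = cauchyAbs x z := fun x z => by
      simp only [cauchyAbs, norm_sub_rev]
    calc ∫⁻ z, ‖modulatedTransform Ω k u z‖ₑ ^ 2 ∂(weightMeasure ε)
        ≤ ∫⁻ z, (∫⁻ x in Ω, cauchyAbs x z * ‖u x‖ₑ) ^ 2 ∂(weightMeasure ε) := by
          refine lintegral_mono fun z => pow_le_pow_left₀ zero_le ?_ 2
          rw [modulatedTransform, enorm_mul]
          refine (mul_le_mul' enorm_one_div_two_pi_le (enorm_cauchyTransform_le z)).trans ?_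
          simp_rw [one_mul, enorm_osc_mul, hsymm _ z]
          rfl
      _ ≤ C * ∫⁻ x in Ω, ‖u x‖ₑ ^ 2 := h Ω hΩ hΩm _ (by fun_prop)
      _ ≤ C * (K * ‖u‖ₑ ^ 2) := by gcongr; exact setLIntegral_sq_le hK u
      _ = (C * K) * ‖u‖ₑ ^ 2 := by ring
      _ ≤ D ^ 2 * ‖u‖ₑ ^ 2 := by
          gcongr
          calc C * K ≤ D := le_add_self
            _ = D ^ 1 := (pow_one _).symm
            _ ≤ D ^ 2 := pow_le_pow_right₀ le_self_add (by norm_num)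
      _ = _ := by rw [mul_pow]
  have hbd' : ∀ u : WeightedL2 ε,
      eLpNorm (modulatedTransform Ω k u) 2 (weightMeasure ε) ≤ D * ‖u‖ₑ := fun u => by
    rw [← ENNReal.pow_le_pow_left_iff two_ne_zero, eLpNorm_two_sq]
    exact hbd u
  have hmem : ∀ u : WeightedL2 ε, MemLp (modulatedTransform Ω k u) 2 (weightMeasure ε) := fun u =>
    ⟨(measurable_modulatedTransform (WeightedL2.measurable u)).aestronglyMeasurable,
      (hbd' u).trans_lt (ENNReal.mul_lt_top hDt.lt_top enorm_lt_top)⟩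
  let A : WeightedL2 ε →L[ℂ] WeightedL2 ε := LinearMap.mkContinuous
    { toFun := fun u => (hmem u).toLp
      map_add' := fun u v => by
        refine Lp.ext ?_
        -- Additivity needs both integrals to converge absolutely, which holds only for almost every
        -- `z`; homogeneity needs no such condition.
        have hi := fun u : WeightedL2 ε =>
          (weightMeasure_absolutelyContinuous_volume (ε := ε)).ae_le
          (ae_integrable_modulated (k := k) hε hKt hK u)
        filter_upwards [(hmem (u + v)).coeFn_toLp, (hmem u).coeFn_toLp, (hmem v).coeFn_toLp,
          Lp.coeFn_add (hmem u).toLp (hmem v).toLp, hi u, hi v] with z h1 h2 h3 h4 h5 h6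
        rw [h1, h4, Pi.add_apply, h2, h3, modulatedTransform_congr (Lp.coeFn_add u v)]
        unfold modulatedTransform cauchyTransform
        rw [← mul_add, ← integral_add h5 h6]
        congr 2 with w
        simp only [Pi.add_apply]
        ring
      map_smul' := fun c u => by
        refine Lp.ext ?_
        filter_upwards [(hmem (c • u)).coeFn_toLp, (hmem u).coeFn_toLp,
          Lp.coeFn_smul c (hmem u).toLp] with z h1 h2 h3
        rw [h1, RingHom.id_apply, h3, Pi.smul_apply, h2,
          modulatedTransform_congr (Lp.coeFn_smul c u)]
        unfold modulatedTransform cauchyTransform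
        rw [smul_eq_mul, mul_left_comm c, ← integral_const_mul c]
        congr 2 with w
        simp only [Pi.smul_apply, smul_eq_mul]
        ring }
    D.toReal fun u => by
      refine norm_le_of_enorm_le hDt ?_
      simp only [LinearMap.coe_mk, AddHom.coe_mk]
      rw [Lp.enorm_toLp]
      exact hbd' u
  exact ⟨A, LinearMap.mkContinuous_norm_le _ ENNReal.toReal_nonneg _, fun u => (hmem u).coeFn_toLp⟩

lemma isOpA_of_ae_eq (hε : 0 < ε) (hKt : K ≠ ⊤) (hΩ : MeasurableSet Ω)
    (hK : (volume : Measure ℂ).restrict Ω ≤ K • weightMeasure ε) (hk : k ≠ 0)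
    {A : WeightedL2 ε →L[ℂ] WeightedL2 ε}
    (hA : ∀ u, ∀ᵐ z ∂(weightMeasure ε), A u z = modulatedTransform Ω k u z) :
    IsOpA (Ω.indicator 1) k A := by
  refine fun u => ⟨?_, ?_⟩
  · filter_upwards [ae_integrable_modulated (k := k) hε hKt hK u] with z hz
    simp_rw [sourceA_div_eq]
    exact ((integrable_indicator_iff hΩ).2 hz).const_mul _
  · filter_upwards [volume_absolutelyContinuous_weightMeasure.ae_le (hA u)] with z hz
    rw [hz, opE_sourceA hΩ hk]
    rfl

lemma sourceA_congr {u v : ℂ → ℂ} (q : ℂ → ℂ) (h : u =ᵐ[volume] v) :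
    sourceA q k u =ᵐ[volume] sourceA q k v := by
  filter_upwards [h] with w hw
  simp only [sourceA, tau, hw]

lemma isOpB_conjOp {A : WeightedL2 ε →L[ℂ] WeightedL2 ε} (σ : ℂ)
    (hA : IsOpA (Ω.indicator 1) k A) : IsOpB σ (Ω.indicator 1) k (conjOp σ A) := by
  intro u
  have hc : conjL2 u =ᵐ[volume] fun w => conj (u w) :=
    volume_absolutelyContinuous_weightMeasure.ae_le (coeFn_conjL2 u)
  have hs := sourceA_congr (k := k) (Ω.indicator 1) hc
  obtain ⟨h1, h2⟩ := hA (conjL2 u)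
  constructor
  · filter_upwards [h1] with z hz
    have h3 : Integrable fun w =>
        sourceA (Ω.indicator 1) k (fun w => conj (u w)) w / (z - w) :=
      hz.congr (hs.mono fun w hw => by simp only [hw])
    have h4 := (Complex.conjCLE : ℂ →L[ℝ] ℂ).integrable_comp h3
    refine h4.congr (Filter.Eventually.of_forall fun w => ?_)
    simp [sourceB_eq]
  · have h5 := volume_absolutelyContinuous_weightMeasure.ae_le
      (Lp.coeFn_smul σ (conjL2 (A (conjL2 u))))
    have h6 := volume_absolutelyContinuous_weightMeasure.ae_le (coeFn_conjL2 (A (conjL2 u)))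
    filter_upwards [h2, h5, h6] with z e2 e5 e6
    rw [conjOp_apply, e5, Pi.smul_apply, e6, e2, opF_sourceB, smul_eq_mul]
    congr 2
    unfold opE
    congr 1
    exact integral_congr_ae (hs.mono fun w hw => by simp only [hw])

/-- The pairing of `A v` with `g` is an oscillatory integral over `Ω`. -/
lemma inner_eq_integral (hε : 0 < ε) (hΩm : MeasurableSet Ω) (R : ℝ)
    (hΩ : Ω ⊆ Metric.ball (0 : ℂ) R) (hKt : K ≠ ⊤)
    (hK : (volume : Measure ℂ).restrict Ω ≤ K • weightMeasure ε)
    {A : WeightedL2 ε →L[ℂ] WeightedL2 ε}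
    (hA : ∀ u, ∀ᵐ z ∂(weightMeasure ε), A u z = modulatedTransform Ω k u z)
    (v g : WeightedL2 ε) :
    inner ℂ g (A v) = (1 / (2 * Real.pi)) * ∫ w in Ω, osc (-k) w *
      (v w * cauchyTransform (weightMeasure ε) (fun z => -conj (g z)) w) := by
  have hv := WeightedL2.measurable v
  have hg := WeightedL2.measurable g
  have hgc : Measurable fun z => conj (g z) := Complex.continuous_conj.measurable.comp hg
  have hgn : ∀ z, ‖conj (g z)‖ₑ = ‖g z‖ₑ := fun z => by
    rw [← ofReal_norm, ← ofReal_norm, RCLike.norm_conj]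
  set f : ℂ → ℂ → ℂ := fun z w => osc (-k) w * v w / (z - w) * conj (g z) with hf
  have hfm : Measurable (Function.uncurry f) := by
    have : Measurable fun p : ℂ × ℂ => conj (g p.1) := hgc.comp measurable_fst
    simp only [Function.uncurry_def, hf]
    fun_prop
  -- The hypothesis of Fubini: the potential of `|v|` over `Ω` is square integrable for the weight,
  -- and so is `g`.
  have hint : Integrable (Function.uncurry f)
      ((weightMeasure ε).prod (volume.restrict Ω)) := by
    refine ⟨hfm.aestronglyMeasurable, ?_⟩
    obtain ⟨C, hC, h⟩ := exists_lintegral_weightMeasure_sq_cauchyAbs_le hε R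
    have h2 := h Ω hΩ hΩm (fun w => ‖v w‖ₑ) (by fun_prop)
    rw [HasFiniteIntegral, lintegral_prod _ (by fun_prop)]
    have hmP : Measurable fun z => ∫⁻ w in Ω, cauchyAbs w z * ‖v w‖ₑ :=
      Measurable.lintegral_prod_left' (f := fun p : ℂ × ℂ => cauchyAbs p.1 p.2 * ‖v p.1‖ₑ)
        (by fun_prop)
    have e : ∀ z, ∫⁻ w in Ω, ‖Function.uncurry f (z, w)‖ₑ =
        (∫⁻ w in Ω, cauchyAbs w z * ‖v w‖ₑ) * ‖g z‖ₑ := fun z => by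
      rw [← lintegral_mul_const _ (by unfold cauchyAbs; fun_prop)]
      refine lintegral_congr fun w => ?_
      simp only [Function.uncurry_apply_pair, hf]
      rw [enorm_mul, hgn, enorm_div_sub (U := fun w => osc (-k) w * v w), enorm_osc_mul]
      simp only [cauchyAbs, norm_sub_rev]
    simp_rw [e]
    have h3 := sq_lintegral_mul_le (μ := weightMeasure ε) hmP.aemeasurable
      (by fun_prop : AEMeasurable (fun z => ‖g z‖ₑ) (weightMeasure ε))
    rw [← WeightedL2.enorm_sq g] at h3
    have h4 : (∫⁻ z, (∫⁻ w in Ω, cauchyAbs w z * ‖v w‖ₑ) * ‖g z‖ₑ ∂(weightMeasure ε)) ^ 2 < ⊤ := by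
      refine h3.trans_lt (ENNReal.mul_lt_top (h2.trans_lt (ENNReal.mul_lt_top hC.lt_top ?_))
        (ENNReal.pow_lt_top enorm_lt_top))
      exact (setLIntegral_sq_le hK v).trans_lt
        (ENNReal.mul_lt_top hKt.lt_top (ENNReal.pow_lt_top enorm_lt_top))
    simpa using h4
  calc inner ℂ g (A v) = ∫ z, (1 / (2 * Real.pi)) * (∫ w in Ω, f z w) ∂(weightMeasure ε) := by
        rw [L2.inner_def]
        refine integral_congr_ae ((hA v).mono fun z hz => ?_)
        simp only [RCLike.inner_apply, hz, modulatedTransform, cauchyTransform, hf]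
        rw [integral_mul_const]
        ring
    _ = (1 / (2 * Real.pi)) * ∫ w in Ω, ∫ z, f z w ∂(weightMeasure ε) := by
        rw [integral_const_mul, integral_integral_swap hint]
    _ = _ := by
        congr 2 with w
        unfold cauchyTransform
        rw [← mul_assoc, ← integral_const_mul]
        congr 1 with z
        simp only [hf]
        -- Dualizing exchanges pole and variable, `1/(z - w) = -1/(w - z)`; this is the origin of
        -- the minus sign before `conj (g z)`.
        rw [← neg_sub w z, div_neg]
        ring

end Operators

/-! ### Decay of the product of the two operators -/

section Smallness

variable {ε : ℝ}

/-- By duality it is enough to bound the pairing of `A B u` with `g`. This is an oscillatory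
integral of two Cauchy transforms, one conjugated, to which `enorm_integral_oscillating_le` applies.
-/
lemma exists_norm_mul_conjOp_le (hε : 0 < ε) (R : ℝ) {K : ℝ≥0∞} (hKt : K ≠ ⊤) :
    ∃ D : ℝ, 0 ≤ D ∧ ∀ Ω ⊆ Metric.ball (0 : ℂ) R, Convex ℝ Ω → MeasurableSet Ω →
      (volume : Measure ℂ).restrict Ω ≤ K • weightMeasure ε →
      ∀ σ : ℂ, ‖σ‖ = 1 → ∀ k y : ℂ, y ≠ 0 → ‖y‖ ≤ 1 → (∀ x, osc (-k) (x + y) = - osc (-k) x) →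
      ∀ A : WeightedL2 ε →L[ℂ] WeightedL2 ε,
        (∀ u, ∀ᵐ z ∂(weightMeasure ε), A u z = modulatedTransform Ω k u z) →
        ‖A * conjOp σ A‖ ≤ D * ‖y‖ := by
  -- One constant dominating both measures in play; `K₁ ≥ 1` also gives `K₁ ≤ K₁ ^ 2`, again
  -- avoiding a square root.
  set K₁ := 1 + K with hK₁
  have hK₁t : K₁ ≠ ⊤ := by simp [hK₁, hKt]
  obtain ⟨c, hc, h⟩ := exists_hasStripEstimates_cauchyTransform hε R hK₁t
  set D := 2 * (c * K₁ * c) with hD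
  have hDt : D ≠ ⊤ :=
    ENNReal.mul_ne_top (by simp) (ENNReal.mul_ne_top (ENNReal.mul_ne_top hc hK₁t) hc)
  refine ⟨D.toReal, ENNReal.toReal_nonneg,
    fun Ω hΩ hconv hΩm hK σ hσ k y hy hy1 hosc A hA => ?_⟩
  have hK1 : (volume : Measure ℂ).restrict Ω ≤ K₁ • weightMeasure ε := by
    refine hK.trans ?_
    gcongr
    exact le_add_self
  have hK2 : weightMeasure ε ≤ K₁ • weightMeasure ε := by
    conv_lhs => rw [← one_smul ℝ≥0∞ (weightMeasure ε)]
    gcongr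
    exact le_self_add
  have key : ∀ u g : WeightedL2 ε,
      ‖inner ℂ g (A (conjOp σ A u))‖ₑ ≤ D * ‖y‖ₑ * (‖u‖ₑ * ‖g‖ₑ) := by
    intro u g
    have hg := WeightedL2.measurable g
    have hu := WeightedL2.measurable (conjL2 u)
    have hgc : Measurable fun z => -conj (g z) :=
      (Complex.continuous_conj.measurable.comp hg).neg
    have hgn : ∀ z, ‖-conj (g z)‖ₑ = ‖g z‖ₑ := fun z => by
      rw [enorm_neg, ← ofReal_norm, ← ofReal_norm, RCLike.norm_conj]
    have hun : ‖conjL2 u‖ₑ = ‖u‖ₑ := by rw [← ofReal_norm, ← ofReal_norm, norm_conjL2]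
    set V := cauchyTransform (volume.restrict Ω) (fun w => osc (-k) w * conjL2 u w) with hV
    set W := cauchyTransform (weightMeasure ε) (fun z => -conj (g z)) with hW
    have estV : HasStripEstimates Ω y (c * (K₁ * ‖u‖ₑ)) V := by
      refine h Ω hΩ hconv hΩm y hy hy1 _ hK1 _ _ (by fun_prop)
        (ENNReal.mul_ne_top hK₁t enorm_ne_top) ?_
      simp_rw [enorm_osc_mul]
      refine (setLIntegral_sq_le hK1 (conjL2 u)).trans ?_
      rw [hun, mul_pow]
      gcongr
      calc K₁ = K₁ ^ 1 := (pow_one _).symm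
        _ ≤ K₁ ^ 2 := pow_le_pow_right₀ le_self_add (by norm_num)
    have estW : HasStripEstimates Ω y (c * ‖g‖ₑ) W := by
      refine h Ω hΩ hconv hΩm y hy hy1 _ hK2 _ _ hgc enorm_ne_top ?_
      simp_rw [hgn]
      rw [WeightedL2.enorm_sq]
    have hpair := enorm_integral_oscillating_le hΩm (measurable_osc (-k)) (norm_osc (-k)) hosc
      (ENNReal.mul_ne_top hc (ENNReal.mul_ne_top hK₁t enorm_ne_top))
      (ENNReal.mul_ne_top hc enorm_ne_top) estV.conj estW
    have hB : ∀ᵐ w : ℂ, conjOp σ A u w = σ * (1 / (2 * Real.pi)) * conj (V w) := by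
      filter_upwards [volume_absolutelyContinuous_weightMeasure.ae_le
          (Lp.coeFn_smul σ (conjL2 (A (conjL2 u)))),
        volume_absolutelyContinuous_weightMeasure.ae_le (coeFn_conjL2 (A (conjL2 u))),
        volume_absolutelyContinuous_weightMeasure.ae_le (hA (conjL2 u))] with w e1 e2 e3
      rw [conjOp_apply, e1, Pi.smul_apply, e2, e3, modulatedTransform, smul_eq_mul, map_mul,
        ← mul_assoc]
      congr 2
      simp [map_ofNat]
    have hI : ∫ w in Ω, osc (-k) w * (conjOp σ A u w * W w) =
        σ * (1 / (2 * Real.pi)) * ∫ w in Ω, osc (-k) w * (conj (V w) * W w) := by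
      rw [← integral_const_mul]
      refine integral_congr_ae (ae_restrict_of_ae (hB.mono fun w hw => ?_))
      simp only [hw]
      ring
    rw [inner_eq_integral hε hΩm R hΩ hKt hK hA, hI, enorm_mul, enorm_mul, enorm_mul]
    have hσ1 : ‖σ‖ₑ = 1 := by rw [← ofReal_norm, hσ]; simp
    calc _ ≤ 1 * (‖σ‖ₑ * 1 * (2 * (‖y‖ₑ * (c * (K₁ * ‖u‖ₑ) * (c * ‖g‖ₑ))))) := by
          gcongr <;> exact enorm_one_div_two_pi_le
      _ = _ := by rw [hσ1, hD]; ring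
  refine ContinuousLinearMap.opNorm_le_bound _ (by positivity) fun u => ?_
  -- Testing against `x` itself gives `‖x‖² ≤ D |y| ‖u‖ ‖x‖`, and one factor `‖x‖` is cancelled.
  set x := A (conjOp σ A u) with hx
  change ‖x‖ ≤ _
  have h1 := norm_le_of_enorm_le (E := ℂ) (F := ℝ) (x := inner ℂ x x) (y := ‖y‖ * (‖u‖ * ‖x‖)) hDt
    (by rw [enorm_mul, enorm_mul, enorm_norm, enorm_norm, enorm_norm, ← mul_assoc]; exact key u x)
  rw [inner_self_eq_norm_sq_to_K, norm_pow, RCLike.norm_ofReal, abs_norm,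
    Real.norm_of_nonneg (by positivity)] at h1
  rcases (norm_nonneg x).eq_or_lt with h0 | h0
  · rw [← h0]; positivity
  · refine le_of_mul_le_mul_right ?_ h0
    calc ‖x‖ * ‖x‖ = ‖x‖ ^ 2 := by ring
      _ ≤ _ := h1
      _ = _ := by ring

end Smallness

end DSII

end

theorem proposition1p2 (Ω : Set ℂ) (hΩ : DSII.IsStrictlyConvexSmoothDomain Ω)
    (σ : ℂ) (hσ : σ = 1 ∨ σ = -1) (ε : ℝ) (hε : ε ∈ Set.Ioc (0 : ℝ) 1) :
    ∃ C : ℝ, ∃ h₀ : ℝ, 0 < C ∧ 0 < h₀ ∧ ∀ k : ℂ, k ≠ 0 →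
      ∃ A B : DSII.WeightedL2 ε →L[ℂ] DSII.WeightedL2 ε,
        DSII.IsOpA (Ω.indicator 1) k A ∧ DSII.IsOpB σ (Ω.indicator 1) k B ∧
        ‖DSII.opK A B‖ ≤ C ∧
        ‖DSII.opK A B * DSII.opK A B‖ ≤ C * (1 / ‖k‖) ∧
        (1 / ‖k‖ ≤ h₀ →
          IsUnit (1 - DSII.opK A B) ∧
          ‖Ring.inverse (1 - DSII.opK A B)‖ ≤ C ∧
          IsUnit (1 - DSII.opK A B * DSII.opK A B) ∧
          IsUnit (1 - A * B) ∧ IsUnit (1 - B * A) ∧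
          Ring.inverse (1 - DSII.opK A B) =
            Ring.inverse (1 - DSII.opK A B * DSII.opK A B) * (1 + DSII.opK A B) ∧
          Ring.inverse (1 - DSII.opK A B) =
            DSII.blockOp (Ring.inverse (1 - A * B)) 0 0 (Ring.inverse (1 - B * A)) *
              DSII.blockOp 1 A B 1) := by
  open DSII in
  have hε0 : 0 < ε := hε.1
  have hσ1 : ‖σ‖ = 1 := by rcases hσ with rfl | rfl <;> simp
  have hΩm : MeasurableSet Ω := hΩ.isOpen.measurableSet
  obtain ⟨R, hR⟩ := hΩ.isBounded.subset_ball 0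
  obtain ⟨K, hKt, hK'⟩ := exists_restrict_le_weightMeasure hε0.le R
  have hK := hK' Ω hR hΩm
  obtain ⟨C₀, hC₀, hA'⟩ := exists_opA hε0 R hKt
  obtain ⟨D, hD, hAB'⟩ := exists_norm_mul_conjOp_le hε0 R hKt
  -- `D` serves small steps `y`, `C₀ ^ 2` large ones, and `π/2` is the ratio of `|y|` to `h`.
  set C₁ := Real.pi / 2 * (D + C₀ ^ 2) with hC₁
  have hC₁0 : 0 ≤ C₁ := by positivity
  have hbig : ∀ {x : ℝ}, x ≤ C₁ → x ≤ 2 * (1 + C₀) + C₁ := fun hx => by linarith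
  -- The first summand is the resolvent bound of `opK_resolvent`; the threshold forces `C₁ h ≤ 1/2`.
  refine ⟨2 * (1 + C₀) + C₁, 1 / (2 * (C₁ + 1)), by positivity, by positivity, fun k hk => ?_⟩
  obtain ⟨A, hAn, hA⟩ := hA' Ω hR hΩm hK k
  have hk0 : 0 < ‖k‖ := norm_pos_iff.2 hk
  have hAB : ‖A * conjOp σ A‖ ≤ C₁ * (1 / ‖k‖) := by
    -- The half period is taken for `-k`, the frequency carried by `A`.
    set y : ℂ := Real.pi * Complex.I / (2 * -k) with hy
    have hyn : ‖y‖ = Real.pi / 2 * (1 / ‖k‖) := by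
      rw [hy]
      simp only [norm_div, norm_mul, Complex.norm_real, Complex.norm_I, norm_neg,
        Complex.norm_ofNat, Real.norm_of_nonneg Real.pi_pos.le]
      field_simp
    have hy0 : y ≠ 0 := norm_pos_iff.1 (by rw [hyn]; positivity)
    rcases le_total ‖y‖ 1 with hy1 | hy1
    · refine (hAB' Ω hR hΩ.convex hΩm hK σ hσ1 k y hy0 hy1
        (osc_add_half_period (neg_ne_zero.2 hk)) A hA).trans ?_
      rw [hyn, hC₁]
      calc D * (Real.pi / 2 * (1 / ‖k‖)) = Real.pi / 2 * D * (1 / ‖k‖) := by ring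
        _ ≤ Real.pi / 2 * (D + C₀ ^ 2) * (1 / ‖k‖) := by gcongr; nlinarith
    · calc ‖A * conjOp σ A‖ ≤ ‖A‖ * ‖conjOp σ A‖ := norm_mul_le _ _
        _ ≤ C₀ * C₀ := by
            gcongr
            exact (norm_conjOp_le hσ1 A).trans hAn
        _ ≤ C₀ ^ 2 * ‖y‖ := by nlinarith [sq_nonneg C₀]
        _ = Real.pi / 2 * C₀ ^ 2 * (1 / ‖k‖) := by rw [hyn]; ring
        _ ≤ C₁ * (1 / ‖k‖) := by rw [hC₁]; gcongr; linarith
  have hBA := (norm_conjOp_mul_le σ A).trans hAB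
  have hBn := (norm_conjOp_le hσ1 A).trans hAn
  have hopA := isOpA_of_ae_eq hε0 hKt hΩm hK hk hA
  refine ⟨A, conjOp σ A, hopA, isOpB_conjOp σ hopA, ?_, ?_, fun hh => ?_⟩
  · exact (norm_opK_le hAn hBn).trans (by linarith)
  · refine (norm_opK_mul_opK_le hAB hBA).trans ?_
    gcongr
    exact hbig le_rfl
  · have hhalf : C₁ * (1 / ‖k‖) ≤ 1 / 2 := by
      calc C₁ * (1 / ‖k‖) ≤ C₁ * (1 / (2 * (C₁ + 1))) := by gcongr
        _ ≤ 1 / 2 := by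
          rw [mul_one_div, div_le_div_iff₀ (by positivity) (by norm_num)]
          linarith
    obtain ⟨r1, r2, r3⟩ := opK_resolvent hAn hBn (hAB.trans hhalf) (hBA.trans hhalf)
    exact ⟨r1, r2.trans (by linarith), r3⟩
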